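/- Let $M$ be a smooth manifold (Hausdorff, paracompact, without boundary), $N\subset M$ any subset, $I_N=\{f\in C^\infty(M): f|_N=0\}$, and let a real Lie algebra $\mathfrak g$ act on $M$ by a Lie algebra homomorphism $\mathfrak g\to\mathfrak X(M)$, $\xi\mapsto\underline\xi$. A vector field $u$ is *tangent to $N$* if $u\,I_N\subset I_N$; let $I_{\mathfrak X}(N)=\{u\in\mathfrak X(M): u\,C^\infty(M)\subset I_N\}$, let $\mathfrak X_{\mathfrak g}(M)$ be the $C^\infty(M)$-submodule of $\mathfrak X(M)$ generated by all $\underline\xi$, and let $I_\Omega(N)\subset\Omega(M)$ be the differential ideal generated by all $\alpha\in\Omega^k(M)$, $k\ge 0$, with $\alpha(u_1,\dots,u_k)\in I_N$ for all $u_1,\dots,u_k$ tangent to $N$. A form $\alpha$ is *reducible* if $\mathcal L_{\underline\xi}\alpha,\ \iota_{\underline\xi}\alpha\in I_\Omega(N)$ for all $\xi\in\mathfrak g$; a vector field $v$ is *reducible* if it is tangent to $N$ and $[v,\underline\xi]\in\mathfrak X_{\mathfrak g}(M)+I_{\mathfrak X}(N)$ for all $\xi\in\mathfrak g$. Let $n\ge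 1$ and let $\omega\in\Omega^{n+1}(M)$ be closed. Let $\mathsf{Ham}_\infty(M,\omega)$ be the graded vector space with degree $0$ part $\{(v,\alpha)\in\mathfrak X(M)\oplus\Omega^{n-1}(M): d\alpha=-\iota_v\omega\}$, degree $i$ part $\Omega^{n-1+i}(M)$ for $1-n\le i\le -1$, and $0$ in all other degrees, with the following multibrackets $l_k$, $k\ge1$. The bracket $l_1$ is zero in degree $0$, is $\beta\mapsto(0,d\beta)$ in degree $-1$, and is $d$ in lower degrees. With $\varsigma(k)=-(-1)^{k(k+1)/2}$, $$l_2((v_1,\alpha_1),(v_2,\alpha_2))=([v_1,v_2],\ \varsigma(2)\,\iota_{v_2}\iota_{v_1}\omega),\qquad l_k((v_1,\alpha_1),\dots,(v_k,\alpha_k))=\varsigma(k)\,\iota_{v_k}\cdots\iota_{v_1}\omega\quad(3\le k\le n+1),$$ and all other brackets (in particular, for $k\ge2$, those with an entry of negative degree) are zero. Suppose that every $\underline\xi$ is tangent to $N$ and that $\omega$ is reducible. Let $\mathsf{Ham}_\infty(M,\omega)_{[N]}\subset\mathsf{Ham}_\infty(M,\omega)$ be the space of reducible observables, spanned by the reducible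 forms of degree $<n-1$ and the pairs $(v,\alpha)$ of degree $0$ with $v$ and $\alpha$ reducible. Let $I_{\mathsf{Ham}_\infty}(N)$ be the linear span of $I_\Omega(N)\cap\Omega^{<n-1}(M)$ and of all pairs $(v,\alpha)\in\mathsf{Ham}_\infty(M,\omega)_{[N]}$ of degree $0$ with $v\in\mathfrak X_{\mathfrak g}(M)+I_{\mathfrak X}(N)$ and $\alpha\in I_\Omega(N)$. Then $\mathsf{Ham}_\infty(M,\omega)_{[N]}$ is closed under the brackets $l_k$ and is an $L_\infty$-algebra with them (in the cohomological convention, $l_k$ of degree $2-k$); $I_{\mathsf{Ham}_\infty}(N)$ is contained in $\mathsf{Ham}_\infty(M,\omega)_{[N]}$ and is a strict $L_\infty$-ideal of it, that is, it is a graded subspace and $l_k(x,y_1,\dots,y_{k-1})\in I_{\mathsf{Ham}_\infty}(N)$ for all $k\ge1$, $x\in I_{\mathsf{Ham}_\infty}(N)$ and $y_i\in\mathsf{Ham}_\infty(M,\omega)_{[N]}$. Consequently the brackets $l_k([y_1],\dots,[y_k])=[l_k(y_1,\dots,y_k)]$ are well defined on the graded quotient $$\mathsf{Ham}_\infty(M,\omega)_N=\mathsf{Ham}_\infty(M,\omega)_{[N]}\big/I_{\mathsf{Ham}_\infty}(N)$$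 and make it an $L_\infty$-algebra. -/

import Mathlib

open scoped Manifold

noncomputable section

namespace MultisymplecticReduction

/-! ### Strict L-infinity algebras, ideals and quotients over the reals -/

section LInfinity

variable {V : Type*} [AddCommGroup V] [Module ℝ V]

/-- A family of multilinear operations with `k` inputs, one for every `k`. -/
abbrev MultiBrackets (V : Type*) [AddCommGroup V] [Module ℝ V] :=
  ∀ k : ℕ, MultilinearMap ℝ (fun _ : Fin k => V) V

/-- The skew Koszul sign `χ(σ)`: the sign of `σ` times `(-1)^(|x (σ i)| |x (σ j)|)` for every
pair `i < j` that `σ` reverses, where `deg i` is the degree of `x i`. -/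
def skewKoszulSign {k : ℕ} (deg : Fin k → ℤ) (σ : Equiv.Perm (Fin k)) : ℤˣ :=
  Equiv.Perm.sign σ *
    ∏ i, ∏ j, if i < j ∧ σ j < σ i then Int.negOnePow (deg (σ i) * deg (σ j)) else 1

/-- The permutations that are increasing on the first `i` places and on the other places. -/
def unshuffles (i m : ℕ) : Finset (Equiv.Perm (Fin m)) :=
  Finset.univ.filter fun σ =>
    ∀ a b : Fin m, a < b → ((b : ℕ) < i ∨ i ≤ (a : ℕ)) → σ a < σ b

/-- The left side of the `m`-th higher Jacobi relation,
`∑_{i + j = m + 1} ∑_{σ ∈ Sh(i, m - i)} (-1)^(i (j - 1)) χ(σ)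
l_j (l_i (x_σ(1), …, x_σ(i)), x_σ(i+1), …, x_σ(m))`; the index below is `i - 1 < m`. -/
def jacobiator (l : MultiBrackets V) {m : ℕ} (deg : Fin m → ℤ) (x : Fin m → V) : V :=
  ∑ i : Fin m, ∑ σ ∈ unshuffles (i + 1) m,
    ((-1) ^ (((i : ℕ) + 1) * (m - (i + 1))) * (skewKoszulSign deg σ : ℤ)) •
      l (m - (i + 1) + 1)
        (Fin.cons (l (i + 1) fun a => x (σ ⟨a, by omega⟩))
          fun b => x (σ ⟨i + 1 + b, by omega⟩))

/-- `V`, graded by the subspaces `gr i`, with the operations `l k`, `k ≥ 1`, is an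
L-infinity algebra (with the cohomological convention that `l k` has degree `2 - k`). -/
structure IsLInfinityAlgebra (gr : ℤ → Submodule ℝ V) (l : MultiBrackets V) : Prop where
  isInternal : DirectSum.IsInternal gr
  bracket_zero : l 0 = 0
  degree : ∀ (k : ℕ) (deg : Fin k → ℤ) (x : Fin k → V), (∀ i, x i ∈ gr (deg i)) →
    l k x ∈ gr (∑ i, deg i + 2 - k)
  skew : ∀ (k : ℕ) (deg : Fin k → ℤ) (x : Fin k → V), (∀ i, x i ∈ gr (deg i)) →
    ∀ σ : Equiv.Perm (Fin k), l k (fun i => x (σ i)) = (skewKoszulSign deg σ : ℤ) • l k x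
  jacobi : ∀ (m : ℕ) (deg : Fin m → ℤ) (x : Fin m → V), (∀ i, x i ∈ gr (deg i)) →
    jacobiator l deg x = 0

/-- A strict L-infinity ideal: a graded subspace that contains `l k y` as soon as it contains
one of the entries of `y`. -/
structure IsStrictIdeal (gr : ℤ → Submodule ℝ V) (l : MultiBrackets V)
    (I : Submodule ℝ V) : Prop where
  graded : I = ⨆ i, I ⊓ gr i
  bracket_mem : ∀ (k : ℕ) (y : Fin k → V), (∃ i, y i ∈ I) → l k y ∈ I

/-- The operations `lS` on a subspace `S` are the restrictions of the operations `l`. -/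
def IsRestriction (l : MultiBrackets V) {S : Submodule ℝ V} (lS : MultiBrackets S) : Prop :=
  ∀ (k : ℕ) (y : Fin k → S), (lS k y : V) = l k fun i => (y i : V)

/-- The operations `lQ` on `V ⧸ I` are induced by the operations `l`:
`lQ ([y 1], …, [y k]) = [l (y 1, …, y k)]`. -/
def IsQuotientOf (l : MultiBrackets V) {I : Submodule ℝ V} (lQ : MultiBrackets (V ⧸ I)) : Prop :=
  ∀ (k : ℕ) (y : Fin k → V), lQ k (fun i => I.mkQ (y i)) = I.mkQ (l k y)

/-- The operations `l` on `V` induce operations on `V ⧸ I`, these are unique, and they make `V ⧸ I`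
with the quotient grading an L-infinity algebra. -/
def HasQuotientAlgebra (gr : ℤ → Submodule ℝ V) (l : MultiBrackets V) (I : Submodule ℝ V) : Prop :=
  ∃! lQ : MultiBrackets (V ⧸ I), IsQuotientOf l lQ ∧
    IsLInfinityAlgebra (fun i => (gr i).map I.mkQ) lQ

end LInfinity

/-! ### Vector fields and differential forms

For a smooth manifold and `A = C^∞(M)`, vector fields are the derivations of `A`, and
differential forms of degree `k` are the alternating `A`-multilinear maps from `k` vector
fields to `A`. -/

section Calculus

variable {A : Type*} [CommRing A] [Algebra ℝ A]

/-- Vector fields, as derivations of the algebra of functions, with the commutator bracket. -/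
abbrev VField (A : Type*) [CommRing A] [Algebra ℝ A] := Derivation ℝ A A

/-- Differential forms of degree `k`. -/
abbrev Form (A : Type*) [CommRing A] [Algebra ℝ A] (k : ℕ) := VField A [⋀^Fin k]→ₗ[A] A

/-- The Koszul formula for `dα (u_0, …, u_k)`. In the second sum `u_j` is left out and `u_i`,
`i < j`, is replaced by `[u_i, u_j]`; moving that entry to the front gives the usual
summand `(-1)^(i + j) α ([u_i, u_j], u_0, …, û_i, …, û_j, …, u_k)`. -/
def koszul {k : ℕ} (α : Form A k) (u : Fin (k + 1) → VField A) : A :=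
  (∑ i : Fin (k + 1), (-1) ^ (i : ℕ) • u i (α (i.removeNth u))) +
    ∑ j : Fin (k + 1), ∑ i : Fin k, if i.castSucc < j then
      (-1) ^ (j : ℕ) • α (Function.update (j.removeNth u) i ⁅u i.castSucc, u j⁆) else 0

/-- A form, regarded as multilinear over the reals only. -/
def restr {k : ℕ} (α : Form A k) : VField A [⋀^Fin k]→ₗ[ℝ] A where
  toMultilinearMap := α.toMultilinearMap.restrictScalars ℝ
  map_eq_zero_of_eq' := α.map_eq_zero_of_eq'

/-- The first part of the Koszul formula, before alternation. -/
def dFirst {k : ℕ} (α : Form A k) : VField A →ₗ[ℝ] VField A [⋀^Fin k]→ₗ[ℝ] A where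
  toFun v := (v : A →ₗ[ℝ] A).compAlternatingMap (restr α)
  map_add' _ _ := rfl
  map_smul' _ _ := rfl

theorem bracket_update {k : ℕ} (u : Fin k → VField A) (v : VField A) (i l : Fin k) (h : l ≠ i)
    (x : VField A) : Function.update (Function.update u i x) l ⁅v, Function.update u i x l⁆ =
      Function.update (Function.update u l ⁅v, u l⁆) i x := by
  rw [Function.update_of_ne h, Function.update_comm h.symm]

/-- The second part of the Koszul formula, before alternation. -/
def dSecondAux {k : ℕ} (α : Form A k) (v : VField A) : VField A [⋀^Fin k]→ₗ[ℝ] A where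
  toFun u := ∑ l, α (Function.update u l ⁅v, u l⁆)
  map_update_add' := by
    intro inst u i x y
    obtain rfl : inst = instDecidableEqFin k := Subsingleton.elim _ _
    rw [← Finset.sum_add_distrib]
    refine Finset.sum_congr rfl fun l _ => ?_
    rcases eq_or_ne l i with rfl | h
    · simp
    · simp only [bracket_update u v i l h, AlternatingMap.map_update_add]
  map_update_smul' := by
    intro inst u i c x
    obtain rfl : inst = instDecidableEqFin k := Subsingleton.elim _ _
    rw [Finset.smul_sum]
    refine Finset.sum_congr rfl fun l _ => ?_
    rcases eq_or_ne l i with rfl | h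
    · simp only [Function.update_self, Function.update_idem, lie_smul]
      exact (restr α).map_update_smul u l c ⁅v, x⁆
    · simp only [bracket_update u v i l h]
      exact (restr α).map_update_smul (Function.update u l ⁅v, u l⁆) i c x
  map_eq_zero_of_eq' := by
    intro u i j huv hij
    rw [Fintype.sum_eq_add i j hij]
    · have := α.map_swap (Function.update u i ⁅v, u i⁆) hij
      have h2 : Function.update u i ⁅v, u i⁆ ∘ (Equiv.swap i j) = Function.update u j ⁅v, u j⁆ := by
        funext l
        simp only [Function.comp, Function.update_apply]
        rcases eq_or_ne l i with rfl | h1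
        · simp [hij, huv, hij.symm]
        · rcases eq_or_ne l j with rfl | h2
          · simp [huv]
          · simp [Equiv.swap_apply_of_ne_of_ne h1 h2, h1, h2]
      rw [h2] at this
      rw [this]; simp
    · rintro l ⟨h1, h2⟩
      exact α.map_eq_zero_of_eq _ (by simp [Function.update_of_ne h1.symm, Function.update_of_ne h2.symm, huv]) hij

/-- `dSecondAux`, linear in the vector field. -/
def dSecond {k : ℕ} (α : Form A k) : VField A →ₗ[ℝ] VField A [⋀^Fin k]→ₗ[ℝ] A where
  toFun := dSecondAux α
  map_add' v w := by
    ext u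
    simp [dSecondAux, ← Finset.sum_add_distrib]
  map_smul' c v := by
    ext u
    simp only [dSecondAux, Finset.smul_sum, AlternatingMap.coe_mk, MultilinearMap.coe_mk, smul_lie,
      RingHom.id_apply, AlternatingMap.smul_apply]
    exact Finset.sum_congr rfl fun l _ =>
      (restr α).map_update_smul u l c _

theorem koszul_pair {k : ℕ} (α : Form A k) (u : Fin (k + 1) → VField A) (w : VField A)
    (a b : Fin k) (hab : a ≤ b) :
    (-1) ^ (b.succ : ℕ) • α (Function.update (b.succ.removeNth u) a w) =
      - ((-1) ^ (a.castSucc : ℕ) • α (Function.update (a.castSucc.removeNth u) b w)) := by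
  have hne : a.castSucc ≠ b.succ := by
    intro h; have := congrArg Fin.val h; simp at this; have : (a:ℕ) ≤ b := hab; omega
  have key := AlternatingMap.neg_one_pow_smul_map_removeNth_add_eq_zero_of_eq α
    (v := Function.update (Function.update u a.castSucc w) b.succ w) (i := a.castSucc) (j := b.succ)
    (by simp [Function.update_of_ne hne]) hne
  have h1 : b.succ.removeNth (Function.update (Function.update u a.castSucc w) b.succ w) =
      Function.update (b.succ.removeNth u) a w := by
    rw [Fin.removeNth_update]
    have : a.castSucc = b.succ.succAbove a := (Fin.succAbove_of_castSucc_lt _ _ (Fin.castSucc_lt_succ_iff.2 hab)).symm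
    rw [this, Fin.removeNth_update_succAbove]
  have h2 : a.castSucc.removeNth (Function.update (Function.update u a.castSucc w) b.succ w) =
      Function.update (a.castSucc.removeNth u) b w := by
    rw [Function.update_comm hne, Fin.removeNth_update]
    have : b.succ = a.castSucc.succAbove b := (Fin.succAbove_of_le_castSucc _ _ (Fin.castSucc_le_castSucc_iff.2 hab)).symm
    rw [this, Fin.removeNth_update_succAbove]
  rw [h1, h2] at key
  rw [add_comm] at key
  exact eq_neg_of_add_eq_zero_left key

theorem koszul_second {k : ℕ} (α : Form A k) (u : Fin (k + 1) → VField A) :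
    AlternatingMap.alternatizeUncurryFin (dSecond α) u = -((∑ j : Fin (k + 1), ∑ i : Fin k, if i.castSucc < j then
      (-1) ^ (j : ℕ) • α (Function.update (j.removeNth u) i ⁅u i.castSucc, u j⁆) else 0) +
      ∑ j : Fin (k + 1), ∑ i : Fin k, if i.castSucc < j then
      (-1) ^ (j : ℕ) • α (Function.update (j.removeNth u) i ⁅u i.castSucc, u j⁆) else 0) := by
  have h1 : AlternatingMap.alternatizeUncurryFin (dSecond α) u =
      -((∑ j : Fin (k + 1), ∑ i : Fin k, if i.castSucc < j then
      (-1) ^ (j : ℕ) • α (Function.update (j.removeNth u) i ⁅u i.castSucc, u j⁆) else 0) +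
      ∑ j : Fin (k + 1), ∑ i : Fin k, if i.castSucc < j then 0 else
      (-1) ^ (j : ℕ) • α (Function.update (j.removeNth u) i ⁅u i.succ, u j⁆)) := by
    rw [AlternatingMap.alternatizeUncurryFin_apply, ← Finset.sum_add_distrib,
      ← Finset.sum_neg_distrib]
    refine Finset.sum_congr rfl fun j _ => ?_
    rw [← Finset.sum_add_distrib, ← Finset.sum_neg_distrib]
    simp only [dSecond, dSecondAux, LinearMap.coe_mk, AddHom.coe_mk, AlternatingMap.coe_mk,
      MultilinearMap.coe_mk, Finset.smul_sum]
    refine Finset.sum_congr rfl fun l _ => ?_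
    split_ifs with h
    · rw [add_zero, ← smul_neg, Fin.removeNth_apply, Fin.succAbove_of_castSucc_lt _ _ h,
        ← AlternatingMap.map_update_neg, lie_skew]
    · rw [zero_add, ← smul_neg, Fin.removeNth_apply, Fin.succAbove_of_le_castSucc _ _ (not_lt.1 h),
        ← AlternatingMap.map_update_neg, lie_skew]
  rw [h1]
  congr 2
  rw [Fin.sum_univ_castSucc, Fin.sum_univ_succ]
  simp only [Fin.castSucc_lt_last, if_true, Finset.sum_const_zero, add_zero, Fin.not_lt_zero,
    if_false, zero_add]
  rw [Finset.sum_comm]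
  refine Finset.sum_congr rfl fun b _ => Finset.sum_congr rfl fun a _ => ?_
  by_cases hab : a ≤ b
  · rw [if_neg (by simpa using hab), if_pos (Fin.castSucc_lt_succ_iff.2 hab), koszul_pair α u _ a b hab,
      ← smul_neg, ← AlternatingMap.map_update_neg, lie_skew]
  · rw [if_pos (by simpa using hab), if_neg (by rwa [Fin.castSucc_lt_succ_iff])]

/-- The Koszul formula as a real-multilinear alternating map. -/
def koszulReal {k : ℕ} (α : Form A k) : VField A [⋀^Fin (k + 1)]→ₗ[ℝ] A :=
  AlternatingMap.alternatizeUncurryFin (dFirst α) -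
    (1 / 2 : ℝ) • AlternatingMap.alternatizeUncurryFin (dSecond α)

theorem koszulReal_apply {k : ℕ} (α : Form A k) (u : Fin (k + 1) → VField A) :
    koszulReal α u = koszul α u := by
  rw [koszulReal, AlternatingMap.sub_apply, AlternatingMap.smul_apply, koszul_second, koszul,
    AlternatingMap.alternatizeUncurryFin_apply, ← two_smul ℝ, smul_neg, smul_smul]
  norm_num
  rfl

theorem koszulReal_cons_smul {k : ℕ} (α : Form A k) (f : A) (v : VField A)
    (w : Fin k → VField A) :
    koszulReal α (Fin.cons (f • v) w : Fin (k + 1) → VField A) =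
      f • koszulReal α (Fin.cons v w : Fin (k + 1) → VField A) := by
  simp only [koszulReal_apply]
  cases k with
  | zero => simp [koszul]
  | succ m =>
    have hr : ∀ (x : VField A) (b : Fin (m + 1)),
        b.succ.removeNth (Fin.cons x w : Fin (m + 2) → VField A) =
          (Fin.cons x (b.removeNth w) : Fin (m + 1) → VField A) := by
      intro x b
      funext l
      refine Fin.cases ?_ (fun l => ?_) l <;> simp [Fin.removeNth_apply]
    have hα : ∀ (f : A) (w' : Fin m → VField A) (x : VField A),
        α (Fin.cons (f • x) w' : Fin (m + 1) → VField A) =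
          f • α (Fin.cons x w' : Fin (m + 1) → VField A) :=
      fun f w' x => α.toMultilinearMap.cons_smul w' f x
    have hadd : ∀ (w' : Fin m → VField A) (x y : VField A),
        α (Fin.cons (x + y) w' : Fin (m + 1) → VField A) =
          α (Fin.cons x w' : Fin (m + 1) → VField A) + α (Fin.cons y w' : Fin (m + 1) → VField A) :=
      fun w' x y => α.toMultilinearMap.cons_add w' x y
    have hbr : ∀ y : VField A, ⁅f • v, y⁆ = f • ⁅v, y⁆ + (-(y f)) • v := by
      intro y
      ext g
      simp [Derivation.commutator_apply, mul_sub]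
      ring
    have h0 : ∀ x : VField A, Fin.removeNth 0 (Fin.cons x w : Fin (m + 2) → VField A) = w := by
      intro x; funext l; simp
    simp only [koszul, Fin.sum_univ_succ (n := m + 1), Fin.sum_univ_succ (n := m), hr, h0,
      Fin.cons_zero, Fin.cons_succ, Fin.castSucc_zero, Fin.not_lt_zero, if_false, Fin.succ_pos,
      if_true, Fin.update_cons_zero, hbr, hadd, hα, ← Fin.cons_update, Derivation.coe_smul, Pi.smul_apply, Derivation.leibniz, smul_eq_mul, ← Fin.succ_castSucc, Fin.succ_lt_succ_iff]
    have hpow : ∀ (i : ℕ) (a : A), ((-1 : ℤ) ^ i) • a = (-1 : A) ^ i * a := by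
      intro i a; simp [zsmul_eq_mul]
    have hite : ∀ (P : Prop) [Decidable P] (a : A),
        (if P then f * a else 0) = f * (if P then a else 0) := by
      intro P _ a; split_ifs <;> simp
    simp only [hpow, hite, ← Finset.mul_sum, mul_add, Finset.sum_add_distrib, mul_left_comm _ f,
      neg_mul, mul_neg, Finset.sum_neg_distrib, Finset.sum_const_zero, mul_comm (α _) _]
    ring

theorem koszulReal_update_smul {k : ℕ} (α : Form A k) (u : Fin (k + 1) → VField A)
    (i : Fin (k + 1)) (f : A) (x : VField A) :
    koszulReal α (Function.update u i (f • x)) = f • koszulReal α (Function.update u i x) := by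
  have h : ∀ y : VField A, koszulReal α (Function.update u i y) =
      (-1) ^ (i : ℕ) • koszulReal α (Fin.cons y (i.removeNth u) : Fin (k + 1) → VField A) := by
    intro y
    rw [← Fin.insertNth_removeNth, AlternatingMap.map_insertNth]
    rfl
  rw [h, h, koszulReal_cons_smul, smul_comm]

/-- The exterior derivative, given by the invariant (Koszul) formula. -/
def extD {k : ℕ} : Form A k →ₗ[ℝ] Form A (k + 1) where
  toFun α :=
    { toFun := koszul α
      map_update_add' := by
        intro inst u i x y
        obtain rfl : inst = instDecidableEqFin _ := Subsingleton.elim _ _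
        simp only [← koszulReal_apply, AlternatingMap.map_update_add]
      map_update_smul' := by
        intro inst u i f x
        obtain rfl : inst = instDecidableEqFin _ := Subsingleton.elim _ _
        simp only [← koszulReal_apply, koszulReal_update_smul]
      map_eq_zero_of_eq' := by
        intro u i j h hij
        rw [← koszulReal_apply]
        exact (koszulReal α).map_eq_zero_of_eq u h hij }
  map_add' α β := by
    ext u
    simp only [AlternatingMap.coe_mk, MultilinearMap.coe_mk, AlternatingMap.add_apply, koszul,
      map_add, smul_add, Finset.sum_add_distrib, ite_add_zero]
    abel
  map_smul' c α := by
    ext u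
    simp only [AlternatingMap.coe_mk, MultilinearMap.coe_mk, AlternatingMap.smul_apply, koszul,
      Derivation.map_smul, RingHom.id_apply, smul_add, Finset.smul_sum, smul_ite, smul_zero,
      smul_comm c]

/-- The wedge product. -/
def wedge {k l : ℕ} (α : Form A k) (β : Form A l) : Form A (k + l) :=
  ((LinearMap.mul' A A).compAlternatingMap (α.domCoprod β)).domDomCongr finSumFinEquiv

/-- The contraction `ι_v α = α (v, ·, …, ·)` of a form of positive degree, bilinear in `α`
and `v`. -/
def iota {k : ℕ} : Form A (k + 1) →ₗ[ℝ] VField A →ₗ[ℝ] Form A k where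
  toFun α :=
    { toFun := fun v => α.curryLeft v
      map_add' := α.curryLeft.map_add
      map_smul' := fun c v => by
        ext u
        exact (restr α).toMultilinearMap.cons_smul u c v }
  map_add' _ _ := rfl
  map_smul' _ _ := rfl

/-- The contraction `ι_v` in every degree; it is zero on functions. -/
def interior (v : VField A) : ∀ k : ℕ, Form A k →ₗ[ℝ] Form A (k - 1)
  | 0 => 0
  | _ + 1 => iota.flip v

/-- The Lie derivative `L_v = d ι_v + ι_v d`. -/
def lieDeriv (v : VField A) : ∀ k : ℕ, Form A k →ₗ[ℝ] Form A k
  | 0 => iota.flip v ∘ₗ extD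
  | _ + 1 => extD ∘ₗ iota.flip v + iota.flip v ∘ₗ extD

/-- The iterated contraction `(v_1, …, v_k) ↦ ι_{v_k} ⋯ ι_{v_1} α`. -/
def contract : ∀ (k : ℕ) {m : ℕ},
    Form A (m + k) →ₗ[ℝ] MultilinearMap ℝ (fun _ : Fin k => VField A) (Form A m)
  | 0, _ => (MultilinearMap.constLinearEquivOfIsEmpty ℝ ℝ _ _).toLinearMap
  | k + 1, m =>
    { toFun := fun α => LinearMap.uncurryLeft ((contract k (m := m)) ∘ₗ iota α)
      map_add' := fun α β => by ext; simp
      map_smul' := fun c α => by ext; simp }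

/-! ### Tangency, vanishing and reducibility

`J` stands for the ideal of functions that vanish on the constraint set, and `ρ` for the
infinitesimal action `ξ ↦ ξ_M` of the Lie algebra. -/

/-- `u` is tangent to the constraint set. -/
def IsTangent (J : Ideal A) (u : VField A) : Prop := ∀ f ∈ J, u f ∈ J

/-- The vector fields that vanish along the constraint set. -/
def vanishingFields (J : Ideal A) : Submodule A (VField A) where
  carrier := {u | ∀ f : A, u f ∈ J}
  zero_mem' _ := by simp
  add_mem' hu hv f := J.add_mem (hu f) (hv f)
  smul_mem' a _ hu f := J.mul_mem_left a (hu f)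

/-- A graded differential ideal of the algebra of differential forms. -/
structure DiffIdeal (A : Type*) [CommRing A] [Algebra ℝ A] where
  carrier : ∀ k : ℕ, Submodule ℝ (Form A k)
  wedge_left_mem : ∀ (k l : ℕ) (α : Form A k) (β : Form A l),
    β ∈ carrier l → wedge α β ∈ carrier (k + l)
  wedge_right_mem : ∀ (k l : ℕ) (α : Form A k) (β : Form A l),
    α ∈ carrier k → wedge α β ∈ carrier (k + l)
  extD_mem : ∀ (k : ℕ) (α : Form A k), α ∈ carrier k → extD α ∈ carrier (k + 1)

/-- The degree `k` part of the vanishing de Rham ideal: the differential ideal generated by all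
forms whose values on vector fields tangent to the constraint set lie in `J`. -/
def vanishingForms (J : Ideal A) (k : ℕ) : Submodule ℝ (Form A k) :=
  ⨅ (I : DiffIdeal A) (_ : ∀ (m : ℕ) (α : Form A m),
    (∀ u : Fin m → VField A, (∀ i, IsTangent J (u i)) → α u ∈ J) → α ∈ I.carrier m),
    I.carrier k

variable {𝔤 : Type*} [LieRing 𝔤] [LieAlgebra ℝ 𝔤]

/-- The module over the functions that is generated by the fundamental vector fields. -/
def fundamentalModule (ρ : 𝔤 →ₗ⁅ℝ⁆ VField A) : Submodule A (VField A) :=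
  Submodule.span A (Set.range ρ)

/-- The reducible vector fields. -/
def reducibleFields (J : Ideal A) (ρ : 𝔤 →ₗ⁅ℝ⁆ VField A) : Submodule ℝ (VField A) where
  carrier := {v | IsTangent J v ∧ ∀ ξ : 𝔤, ⁅v, ρ ξ⁆ ∈ fundamentalModule ρ ⊔ vanishingFields J}
  zero_mem' := ⟨fun _ _ => by simp, fun ξ => by simp⟩
  add_mem' hu hv := ⟨fun f hf => J.add_mem (hu.1 f hf) (hv.1 f hf), fun ξ => by
    rw [add_lie]; exact add_mem (hu.2 ξ) (hv.2 ξ)⟩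
  smul_mem' c u hu := ⟨fun f hf => by
      simpa [Algebra.smul_def] using J.mul_mem_left _ (hu.1 f hf), fun ξ => by
    rw [smul_lie]; exact Submodule.smul_of_tower_mem _ c (hu.2 ξ)⟩

/-- The reducible forms of degree `k`. -/
def reducibleForms (J : Ideal A) (ρ : 𝔤 →ₗ⁅ℝ⁆ VField A) (k : ℕ) : Submodule ℝ (Form A k) where
  carrier := {α | ∀ ξ : 𝔤, lieDeriv (ρ ξ) k α ∈ vanishingForms J k ∧
    interior (ρ ξ) k α ∈ vanishingForms J (k - 1)}
  zero_mem' ξ := by simp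
  add_mem' hα hβ ξ := by
    rw [map_add, map_add]; exact ⟨add_mem (hα ξ).1 (hβ ξ).1, add_mem (hα ξ).2 (hβ ξ).2⟩
  smul_mem' c α hα ξ := by
    rw [map_smul, map_smul]
    exact ⟨Submodule.smul_mem _ c (hα ξ).1, Submodule.smul_mem _ c (hα ξ).2⟩

/-! ### Observables

Here `n = p + 1`, so that `ω` has degree `n + 1 = p + 2` and Hamiltonian forms have degree
`n - 1 = p`. -/

/-- Tuples `((v, α), β)` of a vector field `v`, a form `α` of degree `n - 1` and forms `β j` of
all degrees `j < n - 1`, not yet subject to the Hamilton equation. -/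
abbrev PreObs (A : Type*) [CommRing A] [Algebra ℝ A] (p : ℕ) :=
  (VField A × Form A p) × (∀ j : Fin p, Form A j)

/-- The grading: pairs `(v, α)` have degree `0`, and forms of degree `n - 1 + i < n - 1` have
degree `i`. -/
def obsGrading (A : Type*) [CommRing A] [Algebra ℝ A] (p : ℕ) (i : ℤ) :
    Submodule ℝ (PreObs A p) where
  carrier := {x | (i ≠ 0 → x.1 = 0) ∧ ∀ j : Fin p, ((j : ℕ) : ℤ) ≠ p + i → x.2 j = 0}
  zero_mem' := ⟨fun _ => rfl, fun _ _ => rfl⟩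
  add_mem' hx hy := ⟨fun h => by simp [hx.1 h, hy.1 h], fun j h => by simp [hx.2 j h, hy.2 j h]⟩
  smul_mem' c x hx := ⟨fun h => by simp [hx.1 h], fun j h => by simp [hx.2 j h]⟩

/-- The grading that a subspace of the space of observables inherits. -/
def subGrading {p : ℕ} (S : Submodule ℝ (PreObs A p)) (i : ℤ) : Submodule ℝ S :=
  (obsGrading A p i).submoduleOf S

/-- The component of degree `m` of `dβ`, for `m ≤ p`. -/
def dComponent {p : ℕ} : ∀ m : ℕ, (∀ j : Fin p, Form A j) →ₗ[ℝ] Form A m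
  | 0 => 0
  | m + 1 => if h : m < p then extD ∘ₗ LinearMap.proj (⟨m, h⟩ : Fin p) else 0

/-- The bracket `l_1`: it is zero on pairs, `β ↦ (0, dβ)` on forms of degree `n - 2`, and `d` on
forms of lower degree. -/
def obsDiff {p : ℕ} : PreObs A p →ₗ[ℝ] PreObs A p :=
  (LinearMap.prod (LinearMap.prod 0 (dComponent p)) (LinearMap.pi fun j => dComponent j)) ∘ₗ
    LinearMap.snd ℝ _ _

/-- The sign `ς(k) = -(-1)^(k(k+1)/2)`. -/
def koszulSign (k : ℕ) : ℝ := -(-1) ^ (k * (k + 1) / 2)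

/-- `ς(k) ι(v_1 ∧ … ∧ v_k) ω = ς(k) ι_{v_k} ⋯ ι_{v_1} ω` if this form has degree `m`, and zero
otherwise. -/
def contractOmega {p : ℕ} (ω : Form A (p + 2)) (k m : ℕ) :
    MultilinearMap ℝ (fun _ : Fin k => VField A) (Form A m) :=
  if h : p + 2 = m + k then koszulSign k • contract k (ω.domDomCongr (finCongr h)) else 0

/-- The Lie bracket of two vector fields, as a multilinear map. -/
def fieldBracket : MultilinearMap ℝ (fun _ : Fin 2 => VField A) (VField A) where
  toFun v := ⁅v 0, v 1⁆
  map_update_add' v i x y := by fin_cases i <;> simp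
  map_update_smul' v i c x := by fin_cases i <;> simp

/-- The projection to the vector field component; it is zero on forms of negative degree. -/
def toField {p : ℕ} : PreObs A p →ₗ[ℝ] VField A := LinearMap.fst ℝ _ _ ∘ₗ LinearMap.fst ℝ _ _

/-- The multibrackets of observables: `l_1` as above,
`l_2 ((v_1, α_1), (v_2, α_2)) = ([v_1, v_2], ς(2) ι(v_1 ∧ v_2) ω)`, and
`l_k ((v_1, α_1), …, (v_k, α_k)) = ς(k) ι(v_1 ∧ … ∧ v_k) ω` for `3 ≤ k ≤ n + 1`; they are zero in
all other cases. -/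
def obsBracket {p : ℕ} (ω : Form A (p + 2)) : MultiBrackets (PreObs A p)
  | 0 => 0
  | 1 => MultilinearMap.ofSubsingleton ℝ _ _ (0 : Fin 1) obsDiff
  | 2 => ((fieldBracket.prod (contractOmega ω 2 p)).prod 0).compLinearMap fun _ => toField
  | k + 3 => ((0 : MultilinearMap ℝ _ (VField A × Form A p)).prod
      (MultilinearMap.pi fun j : Fin p => contractOmega ω (k + 3) j)).compLinearMap fun _ => toField

/-- The observables of `ω`: the tuples `((v, α), β)` with `dα = -ι_v ω`. -/
def observables {p : ℕ} (ω : Form A (p + 2)) : Submodule ℝ (PreObs A p) where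
  carrier := {x | extD x.1.2 = -iota ω x.1.1}
  zero_mem' := by simp
  add_mem' {x y} hx hy := by
    simp only [Set.mem_ofPred_eq] at hx hy
    simp only [Set.mem_ofPred_eq, Prod.fst_add, Prod.snd_add, map_add, hx, hy, neg_add]
  smul_mem' c x hx := by
    simp only [Set.mem_ofPred_eq] at hx
    simp only [Set.mem_ofPred_eq, Prod.smul_fst, Prod.smul_snd, map_smul, hx, smul_neg]

/-- The reducible observables. -/
def reducibleObservables (J : Ideal A) (ρ : 𝔤 →ₗ⁅ℝ⁆ VField A) {p : ℕ} (ω : Form A (p + 2)) :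
    Submodule ℝ (PreObs A p) where
  carrier := {x | x ∈ observables ω ∧ x.1.1 ∈ reducibleFields J ρ ∧
    x.1.2 ∈ reducibleForms J ρ p ∧ ∀ j : Fin p, x.2 j ∈ reducibleForms J ρ j}
  zero_mem' := ⟨zero_mem _, zero_mem _, zero_mem _, fun _ => zero_mem _⟩
  add_mem' hx hy := ⟨add_mem hx.1 hy.1, add_mem hx.2.1 hy.2.1, add_mem hx.2.2.1 hy.2.2.1,
    fun j => add_mem (hx.2.2.2 j) (hy.2.2.2 j)⟩
  smul_mem' c _ hx := ⟨Submodule.smul_mem _ c hx.1, Submodule.smul_mem _ c hx.2.1,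
    Submodule.smul_mem _ c hx.2.2.1, fun j => Submodule.smul_mem _ c (hx.2.2.2 j)⟩

/-- The vanishing observables: the linear span of the forms of degree less than `n - 1` in the
vanishing de Rham ideal and of the reducible pairs `(v, α)` with `v` in the sum of the fundamental
module and the vector fields that vanish along the constraint set, and `α` in the vanishing
de Rham ideal. -/
def vanishingObservables (J : Ideal A) (ρ : 𝔤 →ₗ⁅ℝ⁆ VField A) {p : ℕ} (ω : Form A (p + 2)) :
    Submodule ℝ (PreObs A p) :=
  Submodule.span ℝ
    ({x | x.1 = 0 ∧ ∀ j : Fin p, x.2 j ∈ vanishingForms J j} ∪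
      {x | x ∈ reducibleObservables J ρ ω ∧ x.2 = 0 ∧
        x.1.1 ∈ fundamentalModule ρ ⊔ vanishingFields J ∧ x.1.2 ∈ vanishingForms J p})

/-- The vanishing observables, as a subspace of the reducible observables. -/
def vanishingInReducible (J : Ideal A) (ρ : 𝔤 →ₗ⁅ℝ⁆ VField A) {p : ℕ} (ω : Form A (p + 2)) :
    Submodule ℝ (reducibleObservables J ρ ω) :=
  (vanishingObservables J ρ ω).submoduleOf (reducibleObservables J ρ ω)

end Calculus

/-! ### Manifolds -/

/-- The algebra of smooth functions on a manifold. -/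
abbrev SmoothFn (d : ℕ) (M : Type*) [TopologicalSpace M]
    [ChartedSpace (EuclideanSpace ℝ (Fin d)) M] :=
  ContMDiffMap (𝓡 d) (modelWithCornersSelf ℝ ℝ) M ℝ ((⊤ : ℕ∞) : WithTop ℕ∞)

/-- The ideal of smooth functions that vanish on `N`. -/
def vanishingIdeal (d : ℕ) {M : Type*} [TopologicalSpace M]
    [ChartedSpace (EuclideanSpace ℝ (Fin d)) M] (N : Set M) : Ideal (SmoothFn d M) where
  carrier := {f | ∀ x ∈ N, f x = 0}
  zero_mem' _ _ := rfl
  add_mem' hf hg x hx := by simp [hf x hx, hg x hx]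
  smul_mem' a f hf x hx := by simp [hf x hx]

end MultisymplecticReduction

end

open MultisymplecticReduction

open scoped Manifold

noncomputable section

namespace MultisymplecticReduction

/-! ### Derivations of the algebra of smooth functions -/

/-! ### Hadamard's lemma on normed spaces. -/

section Hadamard

open MeasureTheory

variable {E F : Type*} [NormedAddCommGroup E] [NormedSpace ℝ E] [NormedAddCommGroup F]
  [NormedSpace ℝ F]

/-! Apart from one point, the theorem is algebra over the ring `A` of smooth functions with the
ideal `J` of functions vanishing on `N`. Let T be the sum of the fundamental module and the fields
vanishing along `N` (`trivialFields`).

Jacobi relations. Brackets with at least two entries see only the vector fields, so for two or more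
inputs an entry of negative degree kills every term. For m ≥ 3 pairs of degree 0 only l_{m-1} ∘ l_2
and l_1 ∘ l_m survive. The Hamilton equation and dω = 0 give L_v ω = 0 for the fields involved, and
`neg_one_pow_extD_ctr` then expresses d of an iterated contraction of ω as a signed sum of
contractions in which two fields are replaced by their bracket. The sign ς is what makes the two
surviving terms cancel. In form degree 0 there is no d-term, and the sum vanishes by itself
(`bracketSum_ctr_top`).

Closure and ideal. The forms with values in `J` on tangent fields already constitute a differential
ideal (`mem_vanishingForms`). Reducible fields are closed under brackets and normalize T
(`lie_mem_trivialFields`). Contracting a reducible form with a reducible field gives a reducible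
form (`iota_mem_reducibleForms`); contracting it with a field in T gives a vanishing form
(`iota_mem_vanishingForms_of_trivial`). All brackets are made of d, the bracket of fields and
contractions of ω, so reducible observables are closed under them and a single vanishing entry makes
the result vanishing.

The analytic point is that an `A`-linear map from vector fields to functions sends fields vanishing
along `N` into `J` (`apply_mem_vanishingIdeal`). By bump functions and Hadamard's lemma a field u is
locally ∑ u(y_i) ∂_i in coordinates y_i; the coefficients lie in `J` and come out of the linear map.

The quotient statement is formal: a graded strict ideal lets grading, brackets and identities
descend (`hasQuotientAlgebra`). -/

theorem contDiff_parametric_integral {G : E → ℝ → F} {n : ℕ∞}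
    (hG : ContDiff ℝ n (fun x : E × ℝ => G x.1 x.2)) :
    ContDiff ℝ n (fun z => ∫ t in (0 : ℝ)..1, G z t) := by
  let η : ContDiffBump (0 : ℝ) := ⟨1, 2, one_pos, one_lt_two⟩
  -- The integral is the value at 0 of the convolution of the indicator of (0, 1] with s ↦ G z (-s).
  -- The bump `η` equals 1 on [-1, 1], so it leaves the integral alone and only provides the compact
  -- support.
  have h := contDiffOn_convolution_right_with_param_comp (μ := (volume : Measure ℝ)) (n := n)
    (ContinuousLinearMap.lsmul ℝ ℝ : ℝ →L[ℝ] F →L[ℝ] F)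
    (s := (Set.univ : Set E)) (v := fun _ => (0 : ℝ)) contDiffOn_const
    (f := Set.indicator (Set.Ioc (0 : ℝ) 1) (fun _ => (1 : ℝ)))
    (g := fun z s => η s • G z (-s)) (k := Metric.closedBall (0 : ℝ) 2) isOpen_univ
    (isCompact_closedBall _ _)
    (fun p x _ hx => by
      have hx' : ¬ dist x 0 ≤ 2 := hx
      have : η x = 0 := η.zero_of_le_dist (not_le.1 hx').le
      simp [this])
    ((integrable_indicator_iff measurableSet_Ioc).2 (by simp)).locallyIntegrable
    (by
      apply ContDiff.contDiffOn
      change ContDiff ℝ n (fun x : E × ℝ => η x.2 • G x.1 (-x.2))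
      refine (η.contDiff.comp contDiff_snd).smul ?_
      exact hG.comp (contDiff_fst.prodMk contDiff_snd.neg))
  rw [contDiffOn_univ] at h
  convert h using 2 with z
  rw [convolution_def, intervalIntegral.integral_of_le zero_le_one, ← integral_indicator
    measurableSet_Ioc]
  congr 1 with t
  by_cases ht : t ∈ Set.Ioc (0 : ℝ) 1
  · have : η (-t) = 1 := η.one_of_mem_closedBall (by
      simp only [Metric.mem_closedBall, dist_zero_right, norm_neg, Real.norm_eq_abs]
      exact abs_le.2 ⟨by linarith [ht.1], ht.2⟩)
    simp [ht, this]
  · simp [ht]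

/-- **Hadamard's lemma**. -/
theorem exists_contDiff_eq_add_apply [CompleteSpace F] {f : E → F}
    (hf : ContDiff ℝ (⊤ : ℕ∞) f) (q : E) :
    ∃ G : E → E →L[ℝ] F, ContDiff ℝ (⊤ : ℕ∞) G ∧ G q = fderiv ℝ f q ∧
      ∀ z, f z = f q + G z (z - q) := by
  have hd : ContDiff ℝ (⊤ : ℕ∞) (fderiv ℝ f) := hf.fderiv_right (by simp)
  have hG : ContDiff ℝ (⊤ : ℕ∞) (fun x : E × ℝ => fderiv ℝ f (q + x.2 • (x.1 - q))) :=
    hd.comp (contDiff_const.add (contDiff_snd.smul (contDiff_fst.sub contDiff_const)))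
  refine ⟨fun z => ∫ t in (0 : ℝ)..1, fderiv ℝ f (q + t • (z - q)),
    contDiff_parametric_integral (G := fun z t => fderiv ℝ f (q + t • (z - q))) hG, by simp,
    fun z => ?_⟩
  have hc : Continuous fun t : ℝ => fderiv ℝ f (q + t • (z - q)) :=
    hd.continuous.comp (by fun_prop)
  rw [ContinuousLinearMap.intervalIntegral_apply (hc.intervalIntegrable _ _)]
  have hder : ∀ t ∈ Set.uIcc (0 : ℝ) 1, HasDerivAt (fun t : ℝ => f (q + t • (z - q)))
      (fderiv ℝ f (q + t • (z - q)) (z - q)) t := fun t _ => by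
    have h1 := (hf.differentiable (by simp) (q + t • (z - q))).hasFDerivAt
    have h2 : HasDerivAt (fun t : ℝ => q + t • (z - q)) (z - q) t := by
      simpa using ((hasDerivAt_id t).smul_const (z - q)).const_add q
    exact h1.comp_hasDerivAt t h2
  rw [intervalIntegral.integral_eq_sub_of_hasDerivAt hder
    ((hc.clm_apply continuous_const).intervalIntegrable _ _)]
  simp

end Hadamard

theorem apply_eq_sum_single {d : ℕ} (L : EuclideanSpace ℝ (Fin d) →L[ℝ] ℝ)
    (w : EuclideanSpace ℝ (Fin d)) :
    L w = ∑ i, w i * L (EuclideanSpace.single i 1) := by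
  conv_lhs => rw [← (EuclideanSpace.basisFun (Fin d) ℝ).sum_repr w]
  simp

/-! ### Locality of derivations and their expression in coordinates. -/

section Locality

open Filter Topology

variable {d : ℕ} {M : Type*} [TopologicalSpace M] [ChartedSpace (EuclideanSpace ℝ (Fin d)) M]
  {x : M} (χ : SmoothBumpFunction (𝓡 d) x)

theorem smoothBumpFunction_eq_zero_of_notMem_source {q : M}
    (hq : q ∉ (extChartAt (𝓡 d) x).source) : χ q = 0 := by
  by_contra h
  exact hq (by simpa using χ.support_subset_source h)

variable [IsManifold (𝓡 d) ((⊤ : ℕ∞) : WithTop ℕ∞) M]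

theorem contDiffOn_comp_extChartAt_symm (x : M) (f : SmoothFn d M) :
    ContDiffOn ℝ (⊤ : ℕ∞) (f ∘ (extChartAt (𝓡 d) x).symm) (extChartAt (𝓡 d) x).target :=
  contMDiffOn_iff_contDiffOn.1 (f.contMDiff.comp_contMDiffOn (contMDiffOn_extChartAt_symm x))

theorem differentiableAt_comp_extChartAt_symm (f : SmoothFn d M) {q : M}
    (hq : q ∈ (extChartAt (𝓡 d) x).source) :
    DifferentiableAt ℝ (f ∘ (extChartAt (𝓡 d) x).symm) (extChartAt (𝓡 d) x q) :=
  ((contDiffOn_comp_extChartAt_symm x f).contDiffAt ((isOpen_extChartAt_target x).mem_nhds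
    ((extChartAt (𝓡 d) x).map_source hq))).differentiableAt (by simp)

variable [T2Space M]

/-- A bump function b at q supported where f = g satisfies b(f - g) = 0. Applying u and evaluating
at q, where b = 1 and f - g = 0, leaves u(f - g)(q) = 0. -/
theorem derivation_congr_of_eventuallyEq (u : VField (SmoothFn d M)) {f g : SmoothFn d M} {q : M}
    (h : ∀ᶠ z in 𝓝 q, f z = g z) : u f q = u g q := by
  obtain ⟨ψ, -, hψ⟩ := (SmoothBumpFunction.nhds_basis_tsupport (I := 𝓡 d) q).mem_iff.1 h
  let b : SmoothFn d M := ⟨ψ, ψ.contMDiff⟩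
  have h0 : b * (f - g) = 0 := by
    ext z
    by_cases hz : z ∈ tsupport ψ
    · simp [show f z = g z from hψ hz]
    · have : b z = 0 := image_eq_zero_of_notMem_tsupport hz
      change b z * (f z - g z) = 0
      rw [this, zero_mul]
  have h1 := congrArg (fun a => u a q) h0
  have h2 : f q = g q := h.self_of_nhds
  have h3 : b q = 1 := ψ.eq_one
  simp only [Derivation.leibniz, map_sub, map_zero, ContMDiffMap.coe_add, Pi.add_apply,
    smul_eq_mul, ContMDiffMap.coe_mul, Pi.mul_apply, ContMDiffMap.coe_sub, Pi.sub_apply, h2, h3,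
    ContMDiffMap.coe_zero, Pi.zero_apply] at h1
  linarith

/-- A function of the coordinates around `x`, cut off by a bump function. -/
def cutoffPullback {g : EuclideanSpace ℝ (Fin d) → ℝ} (hg : ContDiff ℝ (⊤ : ℕ∞) g) :
    SmoothFn d M :=
  ⟨fun q => χ q • g (extChartAt (𝓡 d) x q), χ.contMDiff_smul
    (hg.contMDiff.comp_contMDiffOn contMDiffOn_extChartAt)⟩

/-- A coordinate derivative around `x`, cut off by a bump function. -/
def cutoffDeriv (w : EuclideanSpace ℝ (Fin d)) (f : SmoothFn d M) : SmoothFn d M :=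
  ⟨fun q => χ q • fderiv ℝ (f ∘ (extChartAt (𝓡 d) x).symm) (extChartAt (𝓡 d) x q) w,
    χ.contMDiff_smul (by
      have h := (((contDiffOn_comp_extChartAt_symm x f).fderiv_of_isOpen
        (isOpen_extChartAt_target x) (m := ((⊤ : ℕ∞) : WithTop ℕ∞)) (by simp)).clm_apply
        (contDiffOn_const (c := w)))
      refine h.contMDiffOn.comp contMDiffOn_extChartAt fun q hq => ?_
      exact (extChartAt (𝓡 d) x).map_source (by rwa [extChartAt_source]))⟩

/-- A coordinate vector field around `x`, cut off by a bump function. -/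
def cutoffDerivation (w : EuclideanSpace ℝ (Fin d)) : VField (SmoothFn d M) :=
  Derivation.mk'
    { toFun := cutoffDeriv χ w
      map_add' := fun f g => by
        ext q
        change χ q * fderiv ℝ (f ∘ (extChartAt (𝓡 d) x).symm + g ∘ (extChartAt (𝓡 d) x).symm)
          (extChartAt (𝓡 d) x q) w = χ q * fderiv ℝ (f ∘ (extChartAt (𝓡 d) x).symm)
          (extChartAt (𝓡 d) x q) w + χ q * fderiv ℝ (g ∘ (extChartAt (𝓡 d) x).symm)
          (extChartAt (𝓡 d) x q) w
        -- Off the chart domain differentiability is not available, but there the bump factor makes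
        -- both sides zero.
        by_cases hq : q ∈ (extChartAt (𝓡 d) x).source
        · rw [fderiv_add (differentiableAt_comp_extChartAt_symm f hq)
            (differentiableAt_comp_extChartAt_symm g hq), ← mul_add]
          rfl
        · simp [smoothBumpFunction_eq_zero_of_notMem_source χ hq]
      map_smul' := fun c f => by
        ext q
        change χ q * fderiv ℝ (c • (f ∘ (extChartAt (𝓡 d) x).symm)) (extChartAt (𝓡 d) x q) w =
          c * (χ q * fderiv ℝ (f ∘ (extChartAt (𝓡 d) x).symm) (extChartAt (𝓡 d) x q) w)
        rw [fderiv_const_smul_field, mul_left_comm]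
        rfl }
    fun f g => by
      ext q
      change χ q * fderiv ℝ ((f ∘ (extChartAt (𝓡 d) x).symm) * (g ∘ (extChartAt (𝓡 d) x).symm))
          (extChartAt (𝓡 d) x q) w = f q * (χ q * fderiv ℝ (g ∘ (extChartAt (𝓡 d) x).symm)
          (extChartAt (𝓡 d) x q) w) + g q * (χ q * fderiv ℝ (f ∘ (extChartAt (𝓡 d) x).symm)
          (extChartAt (𝓡 d) x q) w)
      by_cases hq : q ∈ (extChartAt (𝓡 d) x).source
      · rw [fderiv_mul (differentiableAt_comp_extChartAt_symm f hq)
            (differentiableAt_comp_extChartAt_symm g hq)]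
        simp only [Function.comp_apply, (extChartAt (𝓡 d) x).left_inv hq,
          add_apply, smul_apply, smul_eq_mul]
        ring
      · simp [smoothBumpFunction_eq_zero_of_notMem_source χ hq]

theorem cutoffDerivation_apply (w : EuclideanSpace ℝ (Fin d)) (f : SmoothFn d M) (q : M) :
    cutoffDerivation χ w f q =
      χ q * fderiv ℝ (f ∘ (extChartAt (𝓡 d) x).symm) (extChartAt (𝓡 d) x q) w := rfl

/-- A smooth function in the coordinates around `x`, cut off by a bump function. -/
theorem exists_contDiff_eq_mul_extChartAt_symm (f : SmoothFn d M) :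
    ∃ h : EuclideanSpace ℝ (Fin d) → ℝ, ContDiff ℝ (⊤ : ℕ∞) h ∧
      ∀ z ∈ (extChartAt (𝓡 d) x).target,
        h z = χ ((extChartAt (𝓡 d) x).symm z) * f ((extChartAt (𝓡 d) x).symm z) := by
  classical
  let e := extChartAt (𝓡 d) x
  let b : SmoothFn d M := ⟨χ, χ.contMDiff⟩
  -- Extension by zero makes the function smooth on the whole vector space, so Hadamard's lemma
  -- applies without a convex chart.
  refine ⟨fun z => if z ∈ e.target then (b * f) (e.symm z) else 0, ?_,
    fun z hz => if_pos hz⟩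
  rw [contDiff_iff_contDiffAt]
  intro z
  by_cases hz : z ∈ e.target
  · have ht := (isOpen_extChartAt_target (I := 𝓡 d) x).mem_nhds hz
    refine ((contDiffOn_comp_extChartAt_symm x (b * f)).contDiffAt ht).congr_of_eventuallyEq ?_
    filter_upwards [ht] with y hy
    rw [if_pos hy]; rfl
  -- The image of the support is compact, hence closed, and misses z; the extended function is
  -- therefore zero near z.
  · have hK : IsCompact (e '' tsupport χ) := by
      refine χ.hasCompactSupport.isCompact.image_of_continuousOn ?_
      exact (continuousOn_extChartAt x).mono χ.tsupport_subset_extChartAt_source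
    have hzK : z ∈ (e '' tsupport χ)ᶜ := by
      rintro ⟨q, hq, rfl⟩
      exact hz (e.map_source (χ.tsupport_subset_extChartAt_source hq))
    refine contDiffAt_const (c := (0 : ℝ)) |>.congr_of_eventuallyEq ?_
    filter_upwards [hK.isClosed.isOpen_compl.mem_nhds hzK] with y hy
    split_ifs with h
    · have : χ (e.symm y) = 0 := image_eq_zero_of_notMem_tsupport fun hs =>
        hy ⟨_, hs, e.right_inv h⟩
      change χ (e.symm y) * _ = 0
      rw [this, zero_mul]
    · rfl

/-- The value of a derivation at a point is determined by its values on the coordinates. -/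
theorem derivation_apply_eq_sum (u : VField (SmoothFn d M)) (f : SmoothFn d M) {q : M}
    (hq : ∀ᶠ z in 𝓝 q, χ z = 1) :
    u f q = ∑ i : Fin d, u (cutoffPullback χ (g := fun z => z i) (by fun_prop)) q *
      cutoffDerivation χ (EuclideanSpace.single i 1) f q := by
  let e := extChartAt (𝓡 d) x
  have hsrc : q ∈ e.source := by
    by_contra h
    have h1 := smoothBumpFunction_eq_zero_of_notMem_source χ h
    rw [hq.self_of_nhds] at h1
    exact one_ne_zero h1
  have hnhds : e.source ∈ 𝓝 q := (isOpen_extChartAt_source (I := 𝓡 d) x).mem_nhds hsrc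
  obtain ⟨h, hh, hhf⟩ := exists_contDiff_eq_mul_extChartAt_symm χ f
  obtain ⟨G, hG, hGq, hGz⟩ := exists_contDiff_eq_add_apply hh (e q)
  let y : Fin d → SmoothFn d M := fun i => cutoffPullback χ (g := fun z => z i) (by fun_prop)
  let g : Fin d → SmoothFn d M := fun i => cutoffPullback χ
    (g := fun z => G z (EuclideanSpace.single i 1)) (hG.clm_apply contDiff_const)
  let C : ℝ → SmoothFn d M := fun c => algebraMap ℝ _ c
  -- Hadamard's expansion holds only near q, which suffices by locality. Leibniz at q then keeps
  -- only the terms g_i(q) u(y_i)(q), since y_i - y_i(q) vanishes there.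
  have key : u f q = u (C (f q) + ∑ i, (y i - C (e q i)) * g i) q := by
    refine derivation_congr_of_eventuallyEq u ?_
    filter_upwards [hq, hnhds] with z hz hzs
    have hv : ∀ p ∈ e.source, χ p = 1 → h (e p) = f p := fun p hp h1 => by
      rw [hhf _ (e.map_source hp), e.left_inv hp, h1, one_mul]
    have h1 := hGz (e z)
    rw [hv z hzs hz, hv q hsrc hq.self_of_nhds, apply_eq_sum_single] at h1
    rw [h1]
    change _ = f q + ContMDiffMap.coeFnAddMonoidHom (∑ i, (y i - C (e q i)) * g i) z
    rw [map_sum, Finset.sum_apply]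
    refine congrArg _ (Finset.sum_congr rfl fun i _ => ?_)
    change _ = (χ z * e z i - e q i) * (χ z * G (e z) (EuclideanSpace.single i 1))
    rw [hz, one_mul, one_mul]
    rfl
  have hder : ∀ i, cutoffDerivation χ (EuclideanSpace.single i 1) f q = g i q := by
    intro i
    rw [cutoffDerivation_apply]
    change _ = χ q * G (e q) (EuclideanSpace.single i 1)
    rw [hGq]
    congr 2
    refine Filter.EventuallyEq.fderiv_eq ?_
    have hc := (continuousAt_extChartAt_symm' (I := 𝓡 d) hsrc)
    rw [ContinuousAt, e.left_inv hsrc] at hc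
    filter_upwards [hc.eventually hq, (isOpen_extChartAt_target (I := 𝓡 d) x).mem_nhds
      (e.map_source hsrc)] with z hz hzt
    rw [hhf z hzt, hz, one_mul]
    rfl
  rw [key, map_add, map_sum, Derivation.map_algebraMap, zero_add]
  change ContMDiffMap.coeFnAddMonoidHom (∑ i, u ((y i - C (e q i)) * g i)) q = _
  rw [map_sum, Finset.sum_apply]
  refine Finset.sum_congr rfl fun i _ => ?_
  rw [hder, Derivation.leibniz, map_sub, Derivation.map_algebraMap, sub_zero]
  change (χ q * e q i - e q i) * u (g i) q + g i q * u (y i) q = _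
  rw [hq.self_of_nhds, one_mul, sub_self, zero_mul, zero_add, mul_comm]

variable (N : Set M)

/-- A tensorial map sends vector fields that vanish along `N` to functions that vanish on `N`. -/
theorem apply_mem_vanishingIdeal (φ : VField (SmoothFn d M) →ₗ[SmoothFn d M] SmoothFn d M)
    {u : VField (SmoothFn d M)} (hu : u ∈ vanishingFields (vanishingIdeal d N)) :
    φ u ∈ vanishingIdeal d N := by
  intro x hx
  let χ : SmoothBumpFunction (𝓡 d) x := Classical.arbitrary _
  -- A second bump, supported where χ is locally 1, makes the coordinate formula valid at every
  -- point of its support. Thus b • u becomes a global combination of fields with coefficients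
  -- u(y_i), to which linearity of `φ` applies.
  obtain ⟨ψ, hψ, -⟩ := (SmoothBumpFunction.nhds_basis_support (I := 𝓡 d)
    (eventually_eventually_nhds.2 χ.eventuallyEq_one)).mem_iff.1 Filter.univ_mem
  let b : SmoothFn d M := ⟨ψ, ψ.contMDiff⟩
  let y : Fin d → SmoothFn d M := fun i => cutoffPullback χ (g := fun z => z i) (by fun_prop)
  have h : b • u = ∑ i, u (y i) • b • cutoffDerivation χ (EuclideanSpace.single i 1) := by
    ext f q
    change _ = Derivation.coeFnAddMonoidHom
      (∑ i, u (y i) • b • cutoffDerivation χ (EuclideanSpace.single i 1)) f q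
    rw [map_sum, Finset.sum_apply]
    change ψ q * u f q = ContMDiffMap.coeFnAddMonoidHom
      (∑ i, u (y i) * (b * cutoffDerivation χ (EuclideanSpace.single i 1) f)) q
    rw [map_sum, Finset.sum_apply]
    change _ = ∑ i, u (y i) q * (ψ q * cutoffDerivation χ (EuclideanSpace.single i 1) f q)
    by_cases hq : q ∈ tsupport ψ
    · rw [derivation_apply_eq_sum χ u f (hψ hq), Finset.mul_sum]
      exact Finset.sum_congr rfl fun i _ => mul_left_comm _ _ _
    · simp [image_eq_zero_of_notMem_tsupport hq]
  have h1 := congrArg (fun v => φ v x) h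
  simp only [map_sum, map_smul] at h1
  change ψ x * φ u x = ContMDiffMap.coeFnAddMonoidHom
    (∑ i, u (y i) * (b * φ (cutoffDerivation χ (EuclideanSpace.single i 1)))) x at h1
  rw [map_sum, Finset.sum_apply, ψ.eq_one, one_mul] at h1
  rw [h1]
  refine Finset.sum_eq_zero fun i _ => ?_
  change u (y i) x * _ = 0
  rw [hu (y i) x hx, zero_mul]

end Locality

/-! ### Cartan calculus -/

section Cartan

variable {A : Type*} [CommRing A] [Algebra ℝ A]

theorem extD_apply {k : ℕ} (α : Form A k) (u : Fin (k + 1) → VField A) :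
    extD α u = koszul α u := rfl

theorem iota_apply {k : ℕ} (α : Form A (k + 1)) (v : VField A) (u : Fin k → VField A) :
    iota α v u = α (Fin.cons v u : Fin (k + 1) → VField A) := rfl

/-- The engine of the inductions on the degree below: an identity of forms is tested after one
contraction. -/
theorem form_ext_iota {k : ℕ} {α β : Form A (k + 1)} (h : ∀ v, iota α v = iota β v) : α = β := by
  ext u
  rw [← Fin.cons_self_tail u, ← iota_apply, ← iota_apply, h]

theorem neg_one_pow_smul_cons_removeNth {k : ℕ} (α : Form A (k + 1)) (w : Fin (k + 1) → VField A)
    (b : Fin (k + 1)) (x : VField A) :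
    (-1) ^ (b : ℕ) • α (Fin.cons x (b.removeNth w) : Fin (k + 1) → VField A) =
      α (Function.update w b x) := by
  rw [← Fin.insertNth_removeNth, AlternatingMap.map_insertNth]
  rfl

/-- The Koszul terms in which the first slot acts as a derivation or enters a bracket are split off.
In the others every index is shifted by one, so they form the Koszul sum of `iota α v` with the
opposite sign. This is Cartan's formula in disguise. -/
theorem koszul_cons {k : ℕ} (α : Form A (k + 1)) (v : VField A) (w : Fin (k + 1) → VField A) :
    koszul α (Fin.cons v w : Fin (k + 2) → VField A) =
      v (α w) - ∑ i, α (Function.update w i ⁅v, w i⁆) - koszul (iota α v) w := by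
  have hr : ∀ b : Fin (k + 1), b.succ.removeNth (Fin.cons v w : Fin (k + 2) → VField A) =
      (Fin.cons v (b.removeNth w) : Fin (k + 1) → VField A) := by
    intro b
    funext l
    refine Fin.cases ?_ (fun l => ?_) l <;> simp [Fin.removeNth_apply]
  have h0 : Fin.removeNth 0 (Fin.cons v w : Fin (k + 2) → VField A) = w := by
    funext l; simp
  simp only [koszul, Fin.sum_univ_succ (n := k + 1), Fin.sum_univ_succ (n := k), hr, h0,
    Fin.cons_zero, Fin.cons_succ, Fin.castSucc_zero, Fin.not_lt_zero, if_false, Fin.succ_pos,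
    if_true, Fin.update_cons_zero, ← Fin.cons_update, ← Fin.succ_castSucc, Fin.succ_lt_succ_iff,
    iota_apply, Fin.val_succ, pow_succ (-1 : ℤ), mul_neg_one, neg_smul,
    neg_one_pow_smul_cons_removeNth]
  simp only [Finset.sum_add_distrib, Finset.sum_neg_distrib, Fin.val_zero, pow_zero, one_smul,
    Finset.sum_const_zero, zero_add]
  have hite : ∀ (P : Prop) [Decidable P] (a : A),
      (if P then -a else 0) = -(if P then a else 0) := by
    intro P _ a; split_ifs <;> simp
  simp only [hite, Finset.sum_neg_distrib]
  abel

theorem lieDeriv_succ {k : ℕ} (v : VField A) (α : Form A (k + 1)) :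
    lieDeriv v (k + 1) α = extD (iota α v) + iota (extD α) v := rfl

theorem lieDeriv_zero (v : VField A) (α : Form A 0) :
    lieDeriv v 0 α = iota (extD α) v := rfl

theorem lieDeriv_apply : ∀ {k : ℕ} (v : VField A) (α : Form A k) (u : Fin k → VField A),
    lieDeriv v k α u = v (α u) - ∑ i, α (Function.update u i ⁅v, u i⁆)
  | 0, v, α, u => by
    rw [lieDeriv_zero, iota_apply, extD_apply, koszul]
    simp
  | k + 1, v, α, u => by
    rw [lieDeriv_succ, AlternatingMap.add_apply, iota_apply, extD_apply, extD_apply, koszul_cons]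
    abel

theorem iota_lieDeriv {k : ℕ} (v w : VField A) (α : Form A (k + 1)) :
    iota (lieDeriv v (k + 1) α) w = lieDeriv v k (iota α w) - iota α ⁅v, w⁆ := by
  ext u
  rw [AlternatingMap.sub_apply, iota_apply, lieDeriv_apply, lieDeriv_apply, Fin.sum_univ_succ]
  simp only [iota_apply, Fin.cons_zero, Fin.cons_succ, Fin.update_cons_zero, Fin.cons_update]
  abel

/-- Contracting with x lowers the degree by `iota_lieDeriv`; what remains besides the induction
hypothesis is the Jacobi identity for v, w, x. -/
theorem lieDeriv_lie : ∀ {k : ℕ} (v w : VField A) (α : Form A k),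
    lieDeriv ⁅v, w⁆ k α = lieDeriv v k (lieDeriv w k α) - lieDeriv w k (lieDeriv v k α)
  | 0, v, w, α => by
    ext u
    simp [lieDeriv_apply, Derivation.commutator_apply]
  | k + 1, v, w, α => by
    refine form_ext_iota fun x => ?_
    simp only [map_sub, LinearMap.sub_apply, iota_lieDeriv, lieDeriv_lie v w (iota α x), lie_lie]
    abel

theorem iota_extD {k : ℕ} (v : VField A) (α : Form A (k + 1)) :
    iota (extD α) v = lieDeriv v (k + 1) α - extD (iota α v) := by
  rw [lieDeriv_succ]; abel

/-- The proof avoids d ∘ d = 0, which is deduced from this: after contraction only Cartan's formula,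
`lieDeriv_lie` and the lower degree are needed. -/
theorem extD_lieDeriv : ∀ {k : ℕ} (v : VField A) (α : Form A k),
    extD (lieDeriv v k α) = lieDeriv v (k + 1) (extD α)
  | 0, v, α => by
    refine form_ext_iota fun w => ?_
    rw [iota_lieDeriv]
    simp only [← lieDeriv_zero, lieDeriv_lie]
    abel_nf
  | k + 1, v, α => by
    refine form_ext_iota fun w => ?_
    rw [iota_lieDeriv]
    simp only [iota_extD, lieDeriv_lie, iota_lieDeriv, map_sub, extD_lieDeriv v (iota α w)]
    abel

theorem extD_extD : ∀ {k : ℕ} (α : Form A k), extD (extD α) = 0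
  | 0, α => by
    refine form_ext_iota fun w => ?_
    rw [iota_extD, ← lieDeriv_zero, extD_lieDeriv, sub_self, map_zero, LinearMap.zero_apply]
  | k + 1, α => by
    refine form_ext_iota fun w => ?_
    rw [iota_extD, iota_extD, map_sub, extD_extD (iota α w), extD_lieDeriv, sub_zero, sub_self,
      map_zero, LinearMap.zero_apply]

end Cartan

/-! ### The vanishing de Rham ideal and reducibility -/

section Reducibility

variable {A : Type*} [CommRing A] [Algebra ℝ A] {J : Ideal A}

theorem IsTangent.lie {u v : VField A} (hu : IsTangent J u) (hv : IsTangent J v) :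
    IsTangent J ⁅u, v⁆ := fun f hf => by
  rw [Derivation.commutator_apply]
  exact J.sub_mem (hu _ (hv f hf)) (hv _ (hu f hf))

theorem isTangent_update {k : ℕ} {u : Fin k → VField A} (hu : ∀ i, IsTangent J (u i))
    (i : Fin k) {v : VField A} (hv : IsTangent J v) (l : Fin k) :
    IsTangent J (Function.update u i v l) := by
  rcases eq_or_ne l i with rfl | h
  · rwa [Function.update_self]
  · rw [Function.update_of_ne h]; exact hu l

theorem sign_smul_mem {B ι : Type*} [CommRing B] {J : Ideal B} [Fintype ι] [DecidableEq ι]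
    (σ : Equiv.Perm ι) {a : B} (ha : a ∈ J) : Equiv.Perm.sign σ • a ∈ J := by
  rcases Int.units_eq_one_or (Equiv.Perm.sign σ) with h | h <;> simp [h, ha]

theorem wedge_apply_mem {k l : ℕ} (α : Form A k) (β : Form A l) (P : VField A → Prop)
    (h : (∀ u : Fin k → VField A, (∀ i, P (u i)) → α u ∈ J) ∨
      ∀ u : Fin l → VField A, (∀ i, P (u i)) → β u ∈ J)
    (u : Fin (k + l) → VField A) (hu : ∀ i, P (u i)) : wedge α β u ∈ J := by
  change LinearMap.mul' A A ((α.domCoprod β) (u ∘ finSumFinEquiv)) ∈ J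
  rw [AlternatingMap.domCoprod_apply, sum_apply, map_sum]
  refine J.sum_mem fun σ _ => ?_
  induction σ using Quotient.inductionOn' with
  | _ σ =>
    rw [AlternatingMap.domCoprod.summand_mk'', smul_apply, MultilinearMap.domDomCongr_apply,
      MultilinearMap.domCoprod_apply, Units.smul_def, map_zsmul, ← Units.smul_def]
    refine sign_smul_mem σ ?_
    rw [LinearMap.mul'_apply]
    rcases h with h | h
    · exact J.mul_mem_right _ (h _ fun _ => hu _)
    · exact J.mul_mem_left _ (h _ fun _ => hu _)

/-- The Koszul formula differentiates along tangent fields and inserts brackets of tangent fields,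
which are tangent again. -/
theorem extD_apply_mem {k : ℕ} (α : Form A k)
    (h : ∀ u : Fin k → VField A, (∀ i, IsTangent J (u i)) → α u ∈ J)
    (u : Fin (k + 1) → VField A) (hu : ∀ i, IsTangent J (u i)) : extD α u ∈ J := by
  have hs : ∀ (i : ℕ) {a : A}, a ∈ J → (-1 : ℤ) ^ i • a ∈ J := fun i a ha => zsmul_mem ha _
  refine J.add_mem (J.sum_mem fun i _ => hs _ (hu i _ (h _ fun _ => hu _)))
    (J.sum_mem fun j _ => J.sum_mem fun i _ => ?_)
  split_ifs
  · exact hs _ (h _ (isTangent_update (fun _ => hu _) i ((hu _).lie (hu _))))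
  · exact J.zero_mem

/-- The generators are already closed under sums, wedge products with arbitrary forms and d, so
generating a differential ideal adds nothing. -/
theorem mem_vanishingForms {k : ℕ} {α : Form A k} : α ∈ vanishingForms J k ↔
    ∀ u : Fin k → VField A, (∀ i, IsTangent J (u i)) → α u ∈ J := by
  constructor
  · intro hα
    let I : DiffIdeal A :=
      { carrier := fun k =>
          { carrier := {α | ∀ u : Fin k → VField A, (∀ i, IsTangent J (u i)) → α u ∈ J}
            zero_mem' := fun _ _ => J.zero_mem
            add_mem' := fun hα hβ u hu => J.add_mem (hα u hu) (hβ u hu)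
            smul_mem' := fun c α hα u hu => by
              rw [AlternatingMap.smul_apply, Algebra.smul_def]
              exact J.mul_mem_left _ (hα u hu) }
        wedge_left_mem := fun k l α β hβ => wedge_apply_mem α β _ (Or.inr hβ)
        wedge_right_mem := fun k l α β hα => wedge_apply_mem α β _ (Or.inl hα)
        extD_mem := fun k α hα => extD_apply_mem α hα }
    rw [vanishingForms, Submodule.mem_iInf] at hα
    exact (Submodule.mem_iInf _).1 (hα I) fun m α hα => hα
  · intro hα
    rw [vanishingForms, Submodule.mem_iInf]
    exact fun I => (Submodule.mem_iInf _).2 fun hI => hI k α hα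

theorem smul_mem_vanishingForms {k : ℕ} {α : Form A k} (hα : α ∈ vanishingForms J k) (a : A) :
    a • α ∈ vanishingForms J k :=
  mem_vanishingForms.2 fun u hu => J.mul_mem_left a (mem_vanishingForms.1 hα u hu)

theorem extD_mem_vanishingForms {k : ℕ} {α : Form A k} (hα : α ∈ vanishingForms J k) :
    extD α ∈ vanishingForms J (k + 1) :=
  mem_vanishingForms.2 (extD_apply_mem α (mem_vanishingForms.1 hα))

theorem iota_mem_vanishingForms {k : ℕ} {α : Form A (k + 1)} (hα : α ∈ vanishingForms J (k + 1))
    {v : VField A} (hv : IsTangent J v) : iota α v ∈ vanishingForms J k :=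
  mem_vanishingForms.2 fun _ hu => mem_vanishingForms.1 hα _ (Fin.cases hv hu)

theorem lieDeriv_mem_vanishingForms : ∀ {k : ℕ} {α : Form A k}, α ∈ vanishingForms J k →
    ∀ {v : VField A}, IsTangent J v → lieDeriv v k α ∈ vanishingForms J k
  | 0, _, hα, _, hv => iota_mem_vanishingForms (extD_mem_vanishingForms hα) hv
  | _ + 1, _, hα, _, hv => add_mem (extD_mem_vanishingForms (iota_mem_vanishingForms hα hv))
      (iota_mem_vanishingForms (extD_mem_vanishingForms hα) hv)

theorem iota_smul_right {k : ℕ} (α : Form A (k + 1)) (a : A) (v : VField A) :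
    iota α (a • v) = a • iota α v := by
  ext u
  exact α.toMultilinearMap.cons_smul u a v

variable {𝔤 : Type*} [LieRing 𝔤] [LieAlgebra ℝ 𝔤] {ρ : 𝔤 →ₗ⁅ℝ⁆ VField A}

theorem mem_reducibleForms_succ {k : ℕ} {α : Form A (k + 1)} : α ∈ reducibleForms J ρ (k + 1) ↔
    ∀ ξ, lieDeriv (ρ ξ) (k + 1) α ∈ vanishingForms J (k + 1) ∧
      iota α (ρ ξ) ∈ vanishingForms J k := Iff.rfl

theorem mem_reducibleForms_zero {α : Form A 0} : α ∈ reducibleForms J ρ 0 ↔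
    ∀ ξ, lieDeriv (ρ ξ) 0 α ∈ vanishingForms J 0 :=
  ⟨fun h ξ => (h ξ).1, fun h ξ => ⟨h ξ, zero_mem _⟩⟩

theorem vanishingForms_le_reducibleForms (hρ : ∀ ξ, IsTangent J (ρ ξ)) :
    ∀ k : ℕ, vanishingForms J k ≤ reducibleForms J ρ k
  | 0, _, hα => mem_reducibleForms_zero.2 fun ξ => lieDeriv_mem_vanishingForms hα (hρ ξ)
  | _ + 1, _, hα => mem_reducibleForms_succ.2 fun ξ =>
      ⟨lieDeriv_mem_vanishingForms hα (hρ ξ), iota_mem_vanishingForms hα (hρ ξ)⟩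

/-- L_ξ commutes with d, and ι_ξ dα = L_ξ α - d ι_ξ α. -/
theorem extD_mem_reducibleForms : ∀ {k : ℕ} {α : Form A k}, α ∈ reducibleForms J ρ k →
    extD α ∈ reducibleForms J ρ (k + 1)
  | 0, α, hα => mem_reducibleForms_succ.2 fun ξ => by
      rw [← extD_lieDeriv, ← lieDeriv_zero]
      exact ⟨extD_mem_vanishingForms (hα ξ).1, (hα ξ).1⟩
  | k + 1, α, hα => mem_reducibleForms_succ.2 fun ξ => by
      rw [← extD_lieDeriv, iota_extD]
      exact ⟨extD_mem_vanishingForms (hα ξ).1,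
        sub_mem (hα ξ).1 (extD_mem_vanishingForms (hα ξ).2)⟩

/-! ### Trivial vector fields, and contractions with trivial and reducible fields. -/

variable (J ρ) in
/-- The sum of the fundamental module and the vector fields that vanish along the constraint
set. -/
def trivialFields : Submodule A (VField A) := fundamentalModule ρ ⊔ vanishingFields J

theorem trivialFields_induction {p : VField A → Prop} (hf : ∀ (a : A) (ξ : 𝔤), p (a • ρ ξ))
    (hv : ∀ u ∈ vanishingFields J, p u) (hadd : ∀ u v, p u → p v → p (u + v))
    {u : VField A} (hu : u ∈ trivialFields J ρ) : p u := by
  obtain ⟨y, hy, z, hz, rfl⟩ := Submodule.mem_sup.1 hu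
  refine hadd _ _ ?_ (hv z hz)
  obtain ⟨c, rfl⟩ := (Finsupp.mem_span_range_iff_exists_finsupp).1 hy
  refine Finset.sum_induction _ p hadd (hv 0 (zero_mem _)) fun ξ _ => hf _ _

/-- Reducibility speaks only of the generators ξ. For a multiple a • ξ the Leibniz term v(a) • ξ
stays in the fundamental module; for a vanishing field the tangency of v is what is needed. -/
theorem lie_mem_trivialFields {v u : VField A} (hv : v ∈ reducibleFields J ρ)
    (hu : u ∈ trivialFields J ρ) : ⁅v, u⁆ ∈ trivialFields J ρ := by
  refine trivialFields_induction (J := J) (ρ := ρ) (p := fun u => ⁅v, u⁆ ∈ trivialFields J ρ)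
    (fun a ξ => ?_) (fun u hu => ?_) (fun u w hu hw => ?_) hu
  · have : ⁅v, a • ρ ξ⁆ = v a • ρ ξ + a • ⁅v, ρ ξ⁆ := by
      ext f
      simp [Derivation.commutator_apply, mul_sub]
      ring
    rw [this]
    exact add_mem (Submodule.smul_mem _ _ (Submodule.mem_sup_left
      (Submodule.subset_span ⟨ξ, rfl⟩))) (Submodule.smul_mem _ _ (hv.2 ξ))
  · refine Submodule.mem_sup_right fun f => ?_
    rw [Derivation.commutator_apply]
    exact J.sub_mem (hv.1 _ (hu f)) (hu _)
  · rw [lie_add]; exact add_mem hu hw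

theorem lie_mem_reducibleFields {u v : VField A} (hu : u ∈ reducibleFields J ρ)
    (hv : v ∈ reducibleFields J ρ) : ⁅u, v⁆ ∈ reducibleFields J ρ :=
  ⟨hu.1.lie hv.1, fun ξ => by
    rw [lie_lie]
    exact sub_mem (lie_mem_trivialFields hu (hv.2 ξ)) (lie_mem_trivialFields hv (hu.2 ξ))⟩

variable (J) in
/-- Tensorial maps send the vector fields that vanish along the constraint set to functions that
vanish on it. -/
def VanishingIsTensorial : Prop :=
  ∀ (φ : VField A →ₗ[A] A), ∀ u ∈ vanishingFields J, φ u ∈ J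

/-- Contraction is linear over functions, so the fundamental module reduces to the generators ξ,
where reducibility of α applies. Vanishing fields are the one direct use of tensoriality. -/
theorem iota_mem_vanishingForms_of_trivial (hJ : VanishingIsTensorial J) {k : ℕ}
    {α : Form A (k + 1)} (hα : α ∈ reducibleForms J ρ (k + 1)) {u : VField A}
    (hu : u ∈ trivialFields J ρ) : iota α u ∈ vanishingForms J k := by
  refine trivialFields_induction (J := J) (ρ := ρ) (p := fun u => iota α u ∈ vanishingForms J k)
    (fun a ξ => ?_) (fun u hu => ?_) (fun u w hu hw => ?_) hu
  · rw [iota_smul_right]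
    exact smul_mem_vanishingForms (hα ξ).2 a
  · refine mem_vanishingForms.2 fun w _ => ?_
    exact hJ
      { toFun := fun v => iota α v w
        map_add' := fun v v' => by rw [map_add]; rfl
        map_smul' := fun a v => by rw [iota_smul_right]; rfl } u hu
  · rw [map_add]; exact add_mem hu hw

/-- L_ξ ι_v α = ι_v L_ξ α + ι_[ξ,v] α: the first term vanishes because v is tangent, the second
because [ξ, v] is trivial. Moreover ι_ξ ι_v = -ι_v ι_ξ. -/
theorem iota_mem_reducibleForms (hJ : VanishingIsTensorial J) : ∀ {k : ℕ} {α : Form A (k + 1)},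
    α ∈ reducibleForms J ρ (k + 1) → ∀ {v : VField A}, v ∈ reducibleFields J ρ →
    iota α v ∈ reducibleForms J ρ k := by
  intro k α hα v hv
  have h1 : ∀ ξ, lieDeriv (ρ ξ) k (iota α v) ∈ vanishingForms J k := fun ξ => by
    have := iota_lieDeriv (ρ ξ) v α
    rw [eq_sub_iff_add_eq] at this
    rw [← this, ← lie_skew, map_neg]
    exact add_mem (iota_mem_vanishingForms (hα ξ).1 hv.1)
      (neg_mem (iota_mem_vanishingForms_of_trivial hJ hα (hv.2 ξ)))
  cases k with
  | zero => exact mem_reducibleForms_zero.2 h1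
  | succ k =>
    refine mem_reducibleForms_succ.2 fun ξ => ⟨h1 ξ, ?_⟩
    have : iota (iota α v) (ρ ξ) = -iota (iota α (ρ ξ)) v := by
      ext u
      have := α.map_swap (Fin.cons v (Fin.cons (ρ ξ) u : Fin (k + 1) → VField A) : Fin (k + 2) → _)
        (i := 0) (j := 1) (by simp)
      rw [AlternatingMap.neg_apply]
      simp only [iota_apply]
      rw [← neg_eq_iff_eq_neg, ← this]
      congr 1
      funext l
      refine Fin.cases ?_ (fun l => ?_) l
      · simp
      · refine Fin.cases ?_ (fun l => ?_) l
        · simp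
        · have h2 : Equiv.swap (0 : Fin (k + 2)) 1 l.succ.succ = l.succ.succ :=
            Equiv.swap_apply_of_ne_of_ne (by simp) (by simp [Fin.ext_iff])
          simp [h2]
    rw [this]
    exact neg_mem (iota_mem_vanishingForms (hα ξ).2 hv.1)

end Reducibility

/-! ### Iterated contractions -/

section Contraction

variable {A : Type*} [CommRing A] [Algebra ℝ A]

/-- The iterated contraction `contract` of a form whose degree is only propositionally a sum. -/
def ctr (k : ℕ) {n m : ℕ} (h : n = m + k) :
    Form A n →ₗ[ℝ] MultilinearMap ℝ (fun _ : Fin k => VField A) (Form A m) :=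
  contract k ∘ₗ (AlternatingMap.domDomCongrₗ ℝ (finCongr h)).toLinearMap

theorem ctr_succ {k n m : ℕ} (h : n + 1 = m + (k + 1)) (α : Form A (n + 1))
    (v : Fin (k + 1) → VField A) :
    ctr (k + 1) h α v = ctr k (Nat.succ.inj h) (iota α (v 0)) (Fin.tail v) := by
  obtain rfl : n = m + k := Nat.succ.inj h
  rfl

theorem ctr_cons {k n m : ℕ} (h : n + 1 = m + (k + 1)) (α : Form A (n + 1)) (x : VField A)
    (v : Fin k → VField A) :
    ctr (k + 1) h α (Fin.cons x v : Fin (k + 1) → VField A) =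
      ctr k (Nat.succ.inj h) (iota α x) v := by
  rw [ctr_succ]; rfl

theorem ctr_apply : ∀ {k n m : ℕ} (h : n = m + k) (α : Form A n) (v : Fin k → VField A)
    (w : Fin m → VField A),
    ctr k h α v w = α (Fin.append v w ∘ Fin.cast (h.trans (add_comm m k)))
  | 0, n, m, h, α, v, w => by
    obtain rfl : n = m := h
    change α w = _
    congr 1
    funext i
    rw [Fin.append_left_nil v w rfl]
    rfl
  | k + 1, n, m, h, α, v, w => by
    subst h
    change ctr (k + 1) (n := m + k + 1) rfl α v w = _
    rw [ctr_succ, ctr_apply, iota_apply]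
    congr 1
    conv_rhs => rw [← Fin.cons_self_tail v, Fin.append_cons]
    funext i
    refine Fin.cases ?_ (fun i => ?_) i <;> rfl

/-- The iterated contraction is alternating in the vector fields. -/
def ctrAlt (k : ℕ) {n m : ℕ} (h : n = m + k) (α : Form A n) :
    VField A [⋀^Fin k]→ₗ[ℝ] Form A m where
  toMultilinearMap := ctr k h α
  map_eq_zero_of_eq' v i j hv hij := by
    ext w
    change ctr k h α v w = 0
    rw [ctr_apply]
    refine α.map_eq_zero_of_eq _ (i := Fin.cast (by omega) (Fin.castAdd m i))
      (j := Fin.cast (by omega) (Fin.castAdd m j)) (by simpa using hv) ?_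
    simpa [Fin.ext_iff] using hij

/-! ### Cartan's formula for iterated contractions. -/

theorem ctrAlt_apply {k n m : ℕ} (h : n = m + k) (α : Form A n) (v : Fin k → VField A) :
    ctrAlt k h α v = ctr k h α v := rfl

/-- The alternating sum of the values of `g` on the vector fields `v`, two of them replaced by
their bracket. -/
def bracketSum {W : Type*} [AddCommGroup W] {k : ℕ} (g : (Fin k → VField A) → W)
    (v : Fin (k + 1) → VField A) : W :=
  ∑ j : Fin (k + 1), ∑ i : Fin k, if i.castSucc < j then
    (-1) ^ (j : ℕ) • g (Function.update (j.removeNth v) i ⁅v i.castSucc, v j⁆) else 0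

theorem removeNth_succ {k : ℕ} (v : Fin (k + 2) → VField A) (b : Fin (k + 1)) :
    b.succ.removeNth v = (Fin.cons (v 0) (b.removeNth (Fin.tail v)) : Fin (k + 1) → VField A) := by
  funext l
  refine Fin.cases ?_ (fun l => ?_) l <;> simp [Fin.removeNth_apply, Fin.tail]

theorem removeNth_zero' {k : ℕ} (v : Fin (k + 1) → VField A) :
    Fin.removeNth 0 v = Fin.tail v := by
  funext l; simp [Fin.tail]

/-- Pairs that contain index 0 give the first sum; for the other pairs the shift of j costs one
sign. This recursion matches the induction in `neg_one_pow_extD_ctr`. -/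
theorem bracketSum_succ {W : Type*} [AddCommGroup W] {k : ℕ} (g : (Fin (k + 1) → VField A) → W)
    (v : Fin (k + 2) → VField A) :
    bracketSum g v = -(∑ b : Fin (k + 1), (-1) ^ (b : ℕ) •
      g (Fin.cons ⁅v 0, Fin.tail v b⁆ (b.removeNth (Fin.tail v)))) -
      bracketSum (fun t => g (Fin.cons (v 0) t)) (Fin.tail v) := by
  have hite : ∀ (P : Prop) [Decidable P] (a : W),
      (if P then -a else 0) = -(if P then a else 0) := by
    intro P _ a; split_ifs <;> simp
  simp only [bracketSum, Fin.sum_univ_succ (n := k + 1), removeNth_zero', Fin.not_lt_zero, if_false,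
    removeNth_succ, Finset.sum_const_zero, zero_add]
  simp only [Fin.sum_univ_succ (n := k), ← Fin.succ_castSucc, Fin.castSucc_zero, Fin.succ_pos,
    if_true, Fin.update_cons_zero, Fin.succ_lt_succ_iff, ← Fin.cons_update, Fin.val_succ,
    pow_succ (-1 : ℤ), mul_neg_one, neg_smul, hite, Finset.sum_neg_distrib, Finset.sum_add_distrib]
  simp only [Fin.tail]
  abel

/-- The exterior derivative of an iterated contraction. -/
theorem neg_one_pow_extD_ctr : ∀ {k n m : ℕ} (h : n = m + (k + 1)) (α : Form A n)
    (v : Fin (k + 1) → VField A),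
    (-1 : ℤ) ^ (k + 1) • extD (ctr (k + 1) h α v) =
      ctr (k + 1) (m := m + 1) (by omega) (extD α) v -
        ∑ i : Fin (k + 1), (-1 : ℤ) ^ (i : ℕ) •
          ctr k (m := m + 1) (by omega) (lieDeriv (v i) n α) (i.removeNth v) +
      bracketSum (ctr k (m := m + 1) (by omega) α) v
  | 0, n, m, h, α, v => by
    subst h
    rw [ctr_succ, ctr_succ, iota_extD]
    simp [bracketSum]
    rfl
  | k + 1, n, m, h, α, v => by
    obtain ⟨n, rfl⟩ : ∃ n', n = n' + 1 := ⟨m + (k + 1), h⟩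
    have IH := neg_one_pow_extD_ctr (k := k) (n := n) (m := m) (by omega) (iota α (v 0))
      (Fin.tail v)
    -- Moving L past the first contraction creates the terms with [v_0, v_i], which are the pairs
    -- containing index 0 in `bracketSum_succ`. The missing L along v_0 comes from `iota_extD`.
    have h1 : ∀ i : Fin (k + 1), iota (lieDeriv (Fin.tail v i) (n + 1) α) (v 0) =
        lieDeriv (Fin.tail v i) n (iota α (v 0)) + iota α ⁅v 0, Fin.tail v i⁆ := fun i => by
      rw [iota_lieDeriv, ← lie_skew, map_neg, sub_neg_eq_add]
    rw [ctr_succ, ctr_succ, pow_succ, mul_neg_one, neg_smul, IH, bracketSum_succ, iota_extD,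
      Fin.sum_univ_succ (n := k + 1)]
    simp only [removeNth_succ, removeNth_zero', ctr_cons, Fin.val_zero, pow_zero, one_smul,
      Fin.val_succ, pow_succ (-1 : ℤ), mul_neg_one, neg_smul, Finset.sum_neg_distrib, map_sub,
      sub_apply, show ∀ i, v (Fin.succ i) = Fin.tail v i from fun _ => rfl, h1,
      map_add, add_apply, smul_add, Finset.sum_add_distrib]
    abel

/-- Let B be the bracket sum. Closedness says that the derivative part of the Koszul formula plus B
is 0. As the Lie derivatives vanish, `koszul_second` evaluates the derivative part to -2B. Hence -B
= 0. -/
theorem bracketSum_eq_zero {n : ℕ} {α : Form A n} (hα : extD α = 0)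
    (v : Fin (n + 1) → VField A) (hv : ∀ i, lieDeriv (v i) n α = 0) : bracketSum α v = 0 := by
  have h1 : koszul α v = 0 := by rw [← extD_apply, hα]; rfl
  have h2 : ∀ i : Fin (n + 1), v i (α (i.removeNth v)) = dSecond α (v i) (i.removeNth v) := by
    intro i
    have := lieDeriv_apply (v i) α (i.removeNth v)
    rw [hv i] at this
    exact (sub_eq_zero.1 this.symm)
  have h3 := koszul_second α v
  rw [AlternatingMap.alternatizeUncurryFin_apply] at h3
  simp only [koszul, h2] at h1
  change _ + bracketSum α v = 0 at h1
  change _ = -(bracketSum α v + bracketSum α v) at h3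
  rw [h3] at h1
  simpa using h1

end Contraction

/-! ### Unshuffles -/

section Unshuffles

theorem unshuffles_self (m : ℕ) : unshuffles m m = {1} := by
  ext σ
  simp only [unshuffles, Finset.mem_filter, Finset.mem_univ, true_and, Finset.mem_singleton]
  constructor
  · intro h
    have hs : StrictMono σ := fun a b hab => h a b hab (Or.inl b.2)
    have h1 : (σ : Fin m → Fin m) = id := (hs.range_inj strictMono_id).1 (by simp)
    exact Equiv.ext fun i => congrFun h1 i
  · rintro rfl a b hab -
    exact hab

/-- The permutation `i', j, …` where `i'` is the `i`-th place other than `j`, and the remaining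
places follow in increasing order. -/
def frontPerm {k : ℕ} (j : Fin (k + 2)) (i : Fin (k + 1)) : Equiv.Perm (Fin (k + 2)) :=
  -- The first factor lists j in front, the second brings i' to the next place, and the swap
  -- exchanges the two.
  (Fin.cycleRange j).symm * Equiv.Perm.decomposeFin.symm (0, (Fin.cycleRange i).symm) *
    Equiv.swap 0 1

theorem frontPerm_zero {k : ℕ} (j : Fin (k + 2)) (i : Fin (k + 1)) :
    frontPerm j i 0 = j.succAbove i := by
  rw [frontPerm, Equiv.Perm.mul_apply, Equiv.swap_apply_left, Equiv.Perm.mul_apply,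
    ← Fin.succ_zero_eq_one, Equiv.Perm.decomposeFin_symm_apply_succ]
  simp

theorem frontPerm_one {k : ℕ} (j : Fin (k + 2)) (i : Fin (k + 1)) : frontPerm j i 1 = j := by
  rw [frontPerm, Equiv.Perm.mul_apply, Equiv.swap_apply_right, Equiv.Perm.mul_apply,
    Equiv.Perm.decomposeFin_symm_apply_zero]
  simp

theorem frontPerm_succ_succ {k : ℕ} (j : Fin (k + 2)) (i : Fin (k + 1)) (b : Fin k) :
    frontPerm j i b.succ.succ = j.succAbove (i.succAbove b) := by
  have h2 : Equiv.swap (0 : Fin (k + 2)) 1 b.succ.succ = b.succ.succ :=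
    Equiv.swap_apply_of_ne_of_ne (by simp) (by simp [Fin.ext_iff])
  rw [frontPerm, Equiv.Perm.mul_apply, h2, Equiv.Perm.mul_apply,
    Equiv.Perm.decomposeFin_symm_apply_succ]
  simp

theorem sign_frontPerm {k : ℕ} (j : Fin (k + 2)) (i : Fin (k + 1)) :
    (Equiv.Perm.sign (frontPerm j i) : ℤ) = -((-1) ^ (j : ℕ) * (-1) ^ (i : ℕ)) := by
  rw [frontPerm, Equiv.Perm.sign_mul, Equiv.Perm.sign_mul, Equiv.Perm.decomposeFin.symm_sign,
    Equiv.Perm.sign_swap (by simp)]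
  simp

theorem mem_unshuffles_two {k : ℕ} {σ : Equiv.Perm (Fin (k + 2))} :
    σ ∈ unshuffles 2 (k + 2) ↔ σ 0 < σ 1 ∧ StrictMono fun b : Fin k => σ b.succ.succ := by
  simp only [unshuffles, Finset.mem_filter, Finset.mem_univ, true_and]
  constructor
  · intro h
    refine ⟨h 0 1 (by simp) (Or.inl (by simp)), fun a b hab => h _ _ (by simpa using hab)
      (Or.inr (by simp))⟩
  · rintro ⟨h0, h⟩ a b hab hc
    induction a using Fin.cases with
    | zero =>
      induction b using Fin.cases with
      | zero => exact absurd hab (lt_irrefl _)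
      | succ b =>
        induction b using Fin.cases with
        | zero => exact h0
        | succ b => simp at hc
    | succ a =>
      induction a using Fin.cases with
      | zero =>
        rcases hc with hc | hc
        · have : (1 : ℕ) < b := hab
          omega
        · simp at hc
      | succ a =>
        induction b using Fin.cases with
        | zero => simp at hab
        | succ b =>
          induction b using Fin.cases with
          | zero => simp [Fin.lt_def] at hab
          | succ b => exact h (by simpa using hab)

/-- The remaining values enumerate the complement of {σ 0, σ 1} increasingly, and a strictly
increasing enumeration is determined by its range. -/
theorem eq_of_mem_unshuffles_two {k : ℕ} {σ τ : Equiv.Perm (Fin (k + 2))}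
    (hσ : σ ∈ unshuffles 2 (k + 2)) (hτ : τ ∈ unshuffles 2 (k + 2)) (h0 : σ 0 = τ 0)
    (h1 : σ 1 = τ 1) : σ = τ := by
  have hr : ∀ σ : Equiv.Perm (Fin (k + 2)),
      Set.range (fun b : Fin k => σ b.succ.succ) = {σ 0, σ 1}ᶜ := by
    intro σ
    ext y
    obtain ⟨x, rfl⟩ := σ.surjective y
    induction x using Fin.cases with
    | zero => simp
    | succ x =>
      induction x using Fin.cases with
      | zero => simp [Fin.ext_iff]
      | succ x => simp [Fin.ext_iff]
  have h := ((mem_unshuffles_two.1 hσ).2.range_inj (mem_unshuffles_two.1 hτ).2).1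
    (by rw [hr, hr, h0, h1])
  ext x
  induction x using Fin.cases with
  | zero => rw [h0]
  | succ x =>
    induction x using Fin.cases with
    | zero => exact congrArg Fin.val h1
    | succ x => exact congrArg Fin.val (congrFun h x)

theorem frontPerm_mem_unshuffles {k : ℕ} {j : Fin (k + 2)} {i : Fin (k + 1)}
    (h : i.castSucc < j) : frontPerm j i ∈ unshuffles 2 (k + 2) := by
  refine mem_unshuffles_two.2 ⟨?_, ?_⟩
  · rwa [frontPerm_zero, frontPerm_one, Fin.succAbove_of_castSucc_lt _ _ h]
  · simp only [frontPerm_succ_succ]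
    exact (Fin.strictMono_succAbove j).comp (Fin.strictMono_succAbove i)

theorem sum_unshuffles_two {W : Type*} [AddCommMonoid W] {k : ℕ}
    (f : Equiv.Perm (Fin (k + 2)) → W) :
    ∑ σ ∈ unshuffles 2 (k + 2), f σ =
      ∑ j : Fin (k + 2), ∑ i : Fin (k + 1), if i.castSucc < j then f (frontPerm j i) else 0 := by
  rw [← Fintype.sum_prod_type', ← Finset.sum_filter]
  symm
  refine Finset.sum_bij (fun x _ => frontPerm x.1 x.2)
    (fun x hx => frontPerm_mem_unshuffles (Finset.mem_filter.1 hx).2) ?_ ?_ (fun _ _ => rfl)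
  · rintro ⟨j, i⟩ - ⟨j', i'⟩ - h
    dsimp only at h
    have h1 : j = j' := by rw [← frontPerm_one j i, h, frontPerm_one]
    subst h1
    have h2 := frontPerm_zero j i
    rw [h, frontPerm_zero] at h2
    rw [Fin.succAbove_right_injective h2]
  · intro σ hσ
    have h01 := (mem_unshuffles_two.1 hσ).1
    obtain ⟨i, hi⟩ := Fin.exists_succAbove_eq h01.ne
    have hlt : i.castSucc < σ 1 := by
      by_contra h
      rw [Fin.succAbove_of_le_castSucc _ _ (not_lt.1 h)] at hi
      rw [← hi] at h01
      exact h (Fin.castSucc_lt_succ.trans h01)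
    exact ⟨(σ 1, i), by simpa using hlt, eq_of_mem_unshuffles_two (frontPerm_mem_unshuffles hlt) hσ
      (by rw [frontPerm_zero, hi]) (frontPerm_one _ _)⟩

variable {A : Type*} [CommRing A] [Algebra ℝ A]

/-- Turns the unshuffle sum of the Jacobi relation into the sum of the Cartan formula. Moving the
bracket from slot i to the front costs (-1)^i, which cancels against the sign of `frontPerm j i` and
leaves -(-1)^j. -/
theorem sum_unshuffles_bracket {W : Type*} [AddCommGroup W] [Module ℝ W] {k : ℕ}
    (g : VField A [⋀^Fin (k + 1)]→ₗ[ℝ] W) (v : Fin (k + 2) → VField A) :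
    ∑ σ ∈ unshuffles 2 (k + 2), (Equiv.Perm.sign σ : ℤ) •
      g (Fin.cons ⁅v (σ 0), v (σ 1)⁆ fun b => v (σ b.succ.succ)) = -bracketSum g v := by
  rw [sum_unshuffles_two, bracketSum, ← Finset.sum_neg_distrib]
  refine Finset.sum_congr rfl fun j _ => ?_
  rw [← Finset.sum_neg_distrib]
  refine Finset.sum_congr rfl fun i _ => ?_
  split_ifs with h
  · have h1 := g.map_insertNth i ⁅v i.castSucc, v j⁆ (i.removeNth (j.removeNth v))
    rw [Fin.insertNth_removeNth] at h1
    rw [h1, sign_frontPerm, frontPerm_zero, frontPerm_one, Fin.succAbove_of_castSucc_lt _ _ h,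
      neg_smul, mul_smul]
    simp only [frontPerm_succ_succ]
    rfl
  · simp

end Unshuffles

/-! ### Quotients of L-infinity algebras by strict ideals -/

section Quotient

variable {V W : Type*} [AddCommGroup V] [Module ℝ V] [AddCommGroup W] [Module ℝ W]

theorem map_jacobiator (f : V →ₗ[ℝ] W) {l : MultiBrackets V} {l' : MultiBrackets W}
    (h : ∀ (k : ℕ) (y : Fin k → V), f (l k y) = l' k fun i => f (y i)) {m : ℕ} (deg : Fin m → ℤ)
    (x : Fin m → V) : f (jacobiator l deg x) = jacobiator l' deg fun i => f (x i) := by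
  simp only [jacobiator, map_sum, map_zsmul, h]
  refine Finset.sum_congr rfl fun i _ => Finset.sum_congr rfl fun σ _ => ?_
  congr 2
  funext b
  refine Fin.cases ?_ (fun b => ?_) b
  · simp [h]
  · simp

theorem iSupIndep_of_projections {ι : Type*} {gr : ι → Submodule ℝ V}
    (h : ∀ i, ∃ π : V →ₗ[ℝ] V, (∀ x ∈ gr i, π x = x) ∧ ∀ j ≠ i, ∀ x ∈ gr j, π x = 0) :
    iSupIndep gr := by
  intro i
  obtain ⟨π, h1, h2⟩ := h i
  rw [Submodule.disjoint_def]
  intro x hx hx'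
  have : ⨆ j, ⨆ (_ : j ≠ i), gr j ≤ LinearMap.ker π := iSup₂_le fun j hj x hx => h2 j hj x hx
  rw [← h1 x hx]
  exact this hx'

theorem isInternal_of_projections {ι : Type*} [DecidableEq ι] {gr : ι → Submodule ℝ V}
    (h : ∀ i, ∃ π : V →ₗ[ℝ] V, (∀ x ∈ gr i, π x = x) ∧ ∀ j ≠ i, ∀ x ∈ gr j, π x = 0)
    (htop : ⊤ ≤ ⨆ i, gr i) : DirectSum.IsInternal gr :=
  (DirectSum.isInternal_submodule_iff_iSupIndep_and_iSup_eq_top gr).2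
    ⟨iSupIndep_of_projections h, top_le_iff.1 htop⟩

theorem exists_projection {ι : Type*} [DecidableEq ι] {gr : ι → Submodule ℝ V}
    (h : DirectSum.IsInternal gr) (i : ι) :
    ∃ π : V →ₗ[ℝ] V, (∀ x ∈ gr i, π x = x) ∧ ∀ j ≠ i, ∀ x ∈ gr j, π x = 0 := by
  let e := LinearEquiv.ofBijective (DirectSum.coeLinearMap gr) h
  have he : ∀ (j : ι) (x : gr j), e.symm (x : V) = DirectSum.lof ℝ ι (fun j => gr j) j x := by
    intro j x
    rw [LinearEquiv.symm_apply_eq]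
    exact (DirectSum.coeLinearMap_lof gr j x).symm
  refine ⟨(gr i).subtype ∘ₗ DirectSum.component ℝ ι (fun j => gr j) i ∘ₗ e.symm.toLinearMap,
    fun x hx => ?_, fun j hj x hx => ?_⟩
  · change ((DirectSum.component ℝ ι (fun j => gr j) i) (e.symm ((⟨x, hx⟩ : gr i) : V)) : V) = x
    rw [he, DirectSum.component.lof_self]
  · change ((DirectSum.component ℝ ι (fun j => gr j) i) (e.symm ((⟨x, hx⟩ : gr j) : V)) : V) = 0
    rw [he, DirectSum.component.of, dif_neg hj]
    rfl

/-- A graded subspace is stable under the projections to the homogeneous parts, so these descend to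
the quotient and still separate the images. -/
theorem isInternal_map_mkQ {ι : Type*} [DecidableEq ι] {gr : ι → Submodule ℝ V}
    (h : DirectSum.IsInternal gr) {I : Submodule ℝ V} (hI : I = ⨆ i, I ⊓ gr i) :
    DirectSum.IsInternal fun i => (gr i).map I.mkQ := by
  refine isInternal_of_projections (fun i => ?_) ?_
  · obtain ⟨π, h1, h2⟩ := exists_projection h i
    have hπ : I ≤ I.comap π := by
      conv_lhs => rw [hI]
      refine iSup_le fun j x hx => ?_
      rcases eq_or_ne j i with rfl | hj
      · rw [Submodule.mem_comap, h1 x hx.2]; exact hx.1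
      · rw [Submodule.mem_comap, h2 j hj x hx.2]; exact I.zero_mem
    refine ⟨I.mapQ I π hπ, ?_, ?_⟩
    · rintro _ ⟨x, hx, rfl⟩
      rw [Submodule.mkQ_apply, Submodule.mapQ_apply, h1 x hx]
    · rintro j hj _ ⟨x, hx, rfl⟩
      rw [Submodule.mkQ_apply, Submodule.mapQ_apply, h2 j hj x hx, Submodule.Quotient.mk_zero]
  · rw [← Submodule.map_iSup, h.submodule_iSup_eq_top, Submodule.map_top, Submodule.range_mkQ]

/-- A multilinear map that vanishes as soon as one entry lies in `I` depends only on the classes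
of its entries modulo `I`. -/
theorem multilinearMap_eq_of_sub_mem {k : ℕ} (f : MultilinearMap ℝ (fun _ : Fin k => V) W)
    {I : Submodule ℝ V} (hf : ∀ y, (∃ i, y i ∈ I) → f y = 0) {y z : Fin k → V}
    (h : ∀ i, y i - z i ∈ I) : f y = f z := by
  classical
  -- Entries are exchanged one at a time; each exchange changes the value by f of a tuple with an
  -- entry in `I`.
  have key : ∀ s : Finset (Fin k), f (s.piecewise y z) = f z := by
    intro s
    induction s using Finset.induction_on with
    | empty => simp
    | insert a s ha ih =>
      have h2 : s.piecewise y z = Function.update (s.piecewise y z) a (z a) := by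
        rw [Function.eq_update_iff]
        simp [ha]
      rw [← ih, ← sub_eq_zero, Finset.piecewise_insert]
      conv_lhs => rw [h2]
      rw [Function.update_idem, ← MultilinearMap.map_update_sub]
      exact hf _ ⟨a, by simpa using h a⟩
  simpa using key Finset.univ

/-- Pulling back along a linear section `s` gives multilinear operations at once; the ideal property
makes them agree with l on all representatives. Homogeneous classes have homogeneous
representatives, so the identities descend, and surjectivity of the projection gives uniqueness. -/
theorem hasQuotientAlgebra {gr : ℤ → Submodule ℝ V} {l : MultiBrackets V} {I : Submodule ℝ V}
    (hl : IsLInfinityAlgebra gr l) (hI : IsStrictIdeal gr l I) : HasQuotientAlgebra gr l I := by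
  obtain ⟨s, hs⟩ := I.mkQ.exists_rightInverse_of_surjective I.range_mkQ
  let lQ : MultiBrackets (V ⧸ I) := fun k =>
    (I.mkQ.compMultilinearMap (l k)).compLinearMap fun _ => s
  have hq : IsQuotientOf l lQ := fun k y => by
    refine multilinearMap_eq_of_sub_mem (I.mkQ.compMultilinearMap (l k)) (I := I) (fun y hy => ?_)
      fun i => ?_
    · exact (Submodule.Quotient.mk_eq_zero I).2 (hI.bracket_mem k y hy)
    · rw [← Submodule.Quotient.eq]
      exact LinearMap.congr_fun hs (I.mkQ (y i))
  have hlift : ∀ {k : ℕ} {deg : Fin k → ℤ} {x : Fin k → V ⧸ I},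
      (∀ i, x i ∈ (gr (deg i)).map I.mkQ) →
      ∃ y : Fin k → V, (∀ i, y i ∈ gr (deg i)) ∧ x = fun i => I.mkQ (y i) := by
    intro k deg x hx
    choose y hy hy' using hx
    exact ⟨y, hy, funext fun i => (hy' i).symm⟩
  refine ⟨lQ, ⟨hq, isInternal_map_mkQ hl.isInternal hI.graded, ?_, ?_, ?_, ?_⟩, ?_⟩
  · ext y
    simp [lQ, hl.bracket_zero]
  · intro k deg x hx
    obtain ⟨y, hy, rfl⟩ := hlift hx
    rw [hq]
    exact Submodule.mem_map_of_mem (hl.degree k deg y hy)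
  · intro k deg x hx σ
    obtain ⟨y, hy, rfl⟩ := hlift hx
    rw [hq k fun i => y (σ i), hq k y, hl.skew k deg y hy σ, map_zsmul]
  · intro m deg x hx
    obtain ⟨y, hy, rfl⟩ := hlift hx
    rw [← map_jacobiator I.mkQ (fun k y => (hq k y).symm), hl.jacobi m deg y hy, map_zero]
  · rintro l' ⟨hl', -⟩
    funext k
    ext x
    choose y hy using fun i => I.mkQ_surjective (x i)
    obtain rfl : x = fun i => I.mkQ (y i) := funext fun i => (hy i).symm
    rw [hl', hq]

end Quotient

/-! ### Subalgebras of L-infinity algebras -/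

section Subspace

variable {V : Type*} [AddCommGroup V] [Module ℝ V] {gr : ℤ → Submodule ℝ V} {S : Submodule ℝ V}

/-- The linear maps `π i` are the projections to the subspaces `gr i`. -/
structure IsGradingProj (gr : ℤ → Submodule ℝ V) (π : ℤ → V →ₗ[ℝ] V) : Prop where
  mem : ∀ i x, π i x ∈ gr i
  of_mem : ∀ {i x}, x ∈ gr i → π i x = x
  of_mem_ne : ∀ {i j x}, j ≠ i → x ∈ gr j → π i x = 0
  exists_sum : ∀ x, ∃ s : Finset ℤ, ∑ i ∈ s, π i x = x

/-- A subspace stable under the projections is graded, since every element is a finite sum of its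
components. -/
theorem IsGradingProj.le_iSup_inf {π : ℤ → V →ₗ[ℝ] V} (hπ : IsGradingProj gr π)
    {K : Submodule ℝ S} (hK : ∀ x ∈ K, ∀ i, ∃ y ∈ K, (y : V) = π i x) :
    K ≤ ⨆ i, K ⊓ (gr i).submoduleOf S := by
  intro x hx
  choose y hy hyx using hK x hx
  obtain ⟨s, hs⟩ := hπ.exists_sum (x : V)
  have : x = ∑ i ∈ s, y i := by
    apply Subtype.ext
    rw [Submodule.coe_sum]
    simp only [hyx, hs]
  rw [this]
  refine sum_mem fun i _ => Submodule.mem_iSup_of_mem i ⟨hy i, ?_⟩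
  change (y i : V) ∈ gr i
  rw [hyx]
  exact hπ.mem i _

theorem IsGradingProj.isInternal_submoduleOf {π : ℤ → V →ₗ[ℝ] V} (hπ : IsGradingProj gr π)
    (hS : ∀ x ∈ S, ∀ i, π i x ∈ S) : DirectSum.IsInternal fun i => (gr i).submoduleOf S :=
  isInternal_of_projections
    (fun i => ⟨(π i).restrict fun x hx => hS x hx i, fun _ hx => Subtype.ext (hπ.of_mem hx),
      fun _ hj _ hx => Subtype.ext (hπ.of_mem_ne hj hx)⟩)
    ((hπ.le_iSup_inf (K := ⊤) fun x _ i => ⟨⟨_, hS x x.2 i⟩, trivial, rfl⟩).trans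
      (iSup_mono fun _ => inf_le_right))

/-- The restriction of operations to a subspace that is closed under them. -/
def restrictBrackets (l : MultiBrackets V) (S : Submodule ℝ V)
    (h : ∀ (k : ℕ) (y : Fin k → V), (∀ i, y i ∈ S) → l k y ∈ S) : MultiBrackets S :=
  fun k => ((l k).compLinearMap fun _ => S.subtype).codRestrict _ fun y => h k _ fun i => (y i).2

theorem isRestriction_restrictBrackets (l : MultiBrackets V) (S : Submodule ℝ V)
    (h : ∀ (k : ℕ) (y : Fin k → V), (∀ i, y i ∈ S) → l k y ∈ S) :
    IsRestriction l (restrictBrackets l S h) := fun _ _ => rfl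

/-- Only the Jacobi relation is restricted to entries from `S`: for observables it needs the
Hamilton equation, whereas degree and symmetry hold on all tuples. -/
theorem isLInfinityAlgebra_of_isRestriction {l : MultiBrackets V} {lS : MultiBrackets S}
    (hl : IsRestriction l lS) (hint : DirectSum.IsInternal fun i => (gr i).submoduleOf S)
    (hzero : l 0 = 0)
    (hdeg : ∀ (k : ℕ) (deg : Fin k → ℤ) (x : Fin k → V), (∀ i, x i ∈ gr (deg i)) →
      l k x ∈ gr (∑ i, deg i + 2 - k))
    (hskew : ∀ (k : ℕ) (deg : Fin k → ℤ) (x : Fin k → V), (∀ i, x i ∈ gr (deg i)) →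
      ∀ σ : Equiv.Perm (Fin k), l k (fun i => x (σ i)) = (skewKoszulSign deg σ : ℤ) • l k x)
    (hjac : ∀ (m : ℕ) (deg : Fin m → ℤ) (x : Fin m → V), (∀ i, x i ∈ gr (deg i)) →
      (∀ i, x i ∈ S) → jacobiator l deg x = 0) :
    IsLInfinityAlgebra (fun i => (gr i).submoduleOf S) lS where
  isInternal := hint
  bracket_zero := by
    ext y
    rw [hl, hzero]
    rfl
  degree k deg x hx := by
    change (lS k x : V) ∈ gr _
    rw [hl]
    exact hdeg k deg _ hx
  skew k deg x hx σ := Subtype.ext <| by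
    rw [hl, hskew k deg (fun i => (x i : V)) hx σ, ← hl]
    rfl
  jacobi m deg x hx := Subtype.ext <|
    (map_jacobiator S.subtype hl deg x).trans (hjac m deg _ hx fun i => (x i).2)

theorem isStrictIdeal_of_isRestriction {l : MultiBrackets V} {lS : MultiBrackets S}
    (hl : IsRestriction l lS) {π : ℤ → V →ₗ[ℝ] V} (hπ : IsGradingProj gr π)
    (hS : ∀ x ∈ S, ∀ i, π i x ∈ S) {I : Submodule ℝ V} (hI : ∀ x ∈ I, ∀ i, π i x ∈ I)
    (hmem : ∀ (k : ℕ) (y : Fin k → V), (∀ i, y i ∈ S) → (∃ i, y i ∈ I) → l k y ∈ I) :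
    IsStrictIdeal (fun i => (gr i).submoduleOf S) lS (I.submoduleOf S) where
  graded := le_antisymm
    (hπ.le_iSup_inf fun x hx i => ⟨⟨_, hS x x.2 i⟩, hI x hx i, rfl⟩)
    (iSup_le fun _ => inf_le_left)
  bracket_mem k y hy := by
    change (lS k y : V) ∈ I
    rw [hl]
    exact hmem k _ (fun i => (y i).2) hy

end Subspace

/-! ### The L-infinity algebra of observables -/

section Observables

variable {A : Type*} [CommRing A] [Algebra ℝ A] {p : ℕ} {ω : Form A (p + 2)}

theorem contractOmega_of_eq {k m : ℕ} (h : p + 2 = m + k) (v : Fin k → VField A) :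
    contractOmega ω k m v = koszulSign k • ctr k h ω v := by
  rw [contractOmega, dif_pos h]; rfl

theorem contractOmega_of_ne {k m : ℕ} (h : p + 2 ≠ m + k) (v : Fin k → VField A) :
    contractOmega ω k m v = 0 := by
  rw [contractOmega, dif_neg h]; rfl

theorem obsBracket_one (y : Fin 1 → PreObs A p) : obsBracket ω 1 y = obsDiff (y 0) := rfl

/-- `contractOmega` is zero unless the degrees match, so one formula covers l_2 and the higher
brackets alike; `obsBracket_snd` does the same for the lower forms. -/
theorem obsBracket_fst_snd {k : ℕ} (hk : 2 ≤ k) (y : Fin k → PreObs A p) :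
    (obsBracket ω k y).1.2 = contractOmega ω k p fun i => toField (y i) := by
  match k, hk with
  | 2, _ => rfl
  | k + 3, _ => rw [contractOmega_of_ne (by omega)]; rfl

theorem obsBracket_snd {k : ℕ} (hk : 2 ≤ k) (y : Fin k → PreObs A p) (j : Fin p) :
    (obsBracket ω k y).2 j = contractOmega ω k j fun i => toField (y i) := by
  match k, hk with
  | 2, _ => rw [contractOmega_of_ne (by omega)]; rfl
  | k + 3, _ => rfl

theorem toField_obsBracket {k : ℕ} (hk : k ≠ 2) (y : Fin k → PreObs A p) :
    toField (obsBracket ω k y) = 0 := by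
  match k, hk with
  | 0, _ => rfl
  | 1, _ => rfl
  | k + 3, _ => rfl

theorem preObs_ext {x y : PreObs A p} (h1 : toField x = toField y) (h2 : x.1.2 = y.1.2)
    (h3 : ∀ j, x.2 j = y.2 j) : x = y :=
  Prod.ext (Prod.ext h1 h2) (funext h3)

theorem obsBracket_congr {k : ℕ} (hk : 2 ≤ k) {y z : Fin k → PreObs A p}
    (h : ∀ i, toField (y i) = toField (z i)) : obsBracket ω k y = obsBracket ω k z := by
  match k, hk with
  | 2, _ => simp [obsBracket, h]
  | k + 3, _ => simp [obsBracket, h]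

theorem obsBracket_eq_zero {k : ℕ} (hk : 2 ≤ k) {y : Fin k → PreObs A p}
    (h : ∃ i, toField (y i) = 0) : obsBracket ω k y = 0 := by
  obtain ⟨i, hi⟩ := h
  rw [obsBracket_congr (z := Function.update y i 0) hk fun l => ?_]
  · exact (obsBracket ω k).map_coord_zero i (by simp)
  · rcases eq_or_ne l i with rfl | hl
    · simp [hi]
    · simp [hl]

theorem toField_eq_zero_of_mem {i : ℤ} {x : PreObs A p} (hx : x ∈ obsGrading A p i) (hi : i ≠ 0) :
    toField x = 0 := by
  change x.1.1 = 0
  rw [hx.1 hi]; rfl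

theorem snd_eq_zero_of_mem {x : PreObs A p} (hx : x ∈ obsGrading A p 0) : x.2 = 0 :=
  funext fun j => hx.2 j (by have := j.2; omega)

theorem obsDiff_eq_zero {x : PreObs A p} (hx : x.2 = 0) : obsDiff x = 0 := by
  simp only [obsDiff, LinearMap.comp_apply, LinearMap.snd_apply, hx, map_zero]

theorem dComponent_dComponent (β : ∀ j : Fin p, Form A j) : ∀ m : ℕ, m ≤ p →
    dComponent m (fun j : Fin p => dComponent j β) = 0
  | 0, _ => rfl
  | 1, h => by
    rw [dComponent, dif_pos (by omega)]
    exact map_zero extD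
  | m + 2, h => by
    rw [dComponent, dif_pos (by omega)]
    change extD (dComponent (m + 1) β) = 0
    rw [dComponent, dif_pos (by omega)]
    exact extD_extD _

theorem obsDiff_obsDiff (x : PreObs A p) : obsDiff (obsDiff x) = 0 :=
  preObs_ext rfl (dComponent_dComponent x.2 p le_rfl)
    fun j => dComponent_dComponent x.2 j j.2.le

theorem obsDiff_mem_obsGrading {x : PreObs A p} {i : ℤ} (hx : x ∈ obsGrading A p i) :
    obsDiff x ∈ obsGrading A p (i + 1) := by
  have h : ∀ m : ℕ, (m : ℤ) ≠ p + (i + 1) → dComponent m x.2 = 0 := by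
    intro m hm
    cases m with
    | zero => rfl
    | succ m =>
      rw [dComponent]
      split_ifs with h
      · change extD (x.2 ⟨m, h⟩) = 0
        rw [hx.2 ⟨m, h⟩ (by push_cast at hm; simp only; omega), map_zero]
      · rfl
  exact ⟨fun hi => Prod.ext rfl (h p (by omega)), fun j hj => h j hj⟩

theorem obsBracket_mem_obsGrading (k : ℕ) (deg : Fin k → ℤ) (x : Fin k → PreObs A p)
    (hx : ∀ i, x i ∈ obsGrading A p (deg i)) :
    obsBracket ω k x ∈ obsGrading A p (∑ i, deg i + 2 - k) := by
  match k, deg, x, hx with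
  | 0, _, _, _ => exact zero_mem _
  | 1, deg, x, hx =>
    have := obsDiff_mem_obsGrading (hx 0)
    simpa [obsBracket_one, show deg 0 + 2 - 1 = deg 0 + 1 by ring] using this
  | k + 2, deg, x, hx =>
    -- An entry of nonzero degree has no vector field and kills the bracket. Otherwise the result
    -- has degree 2 - k in the shortened sense, that is, form degree p + 2 minus the number of
    -- inputs.
    by_cases h : ∃ i, deg i ≠ 0
    · obtain ⟨i, hi⟩ := h
      rw [obsBracket_eq_zero (by omega) ⟨i, toField_eq_zero_of_mem (hx i) hi⟩]
      exact zero_mem _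
    · push Not at h
      simp only [h, Finset.sum_const_zero]
      refine ⟨fun hk => ?_, fun j hj => ?_⟩
      · have hk' : k + 2 ≠ 2 := by rintro h; rw [h] at hk; simp at hk
        refine Prod.ext (toField_obsBracket hk' x) ?_
        rw [obsBracket_fst_snd (by omega), contractOmega_of_ne (by omega)]; rfl
      · rw [obsBracket_snd (by omega), contractOmega_of_ne]
        push_cast at hj
        omega

variable (A) in
/-- The Lie bracket of vector fields, as an alternating map. -/
def fieldBracketAlt : VField A [⋀^Fin 2]→ₗ[ℝ] VField A where
  toMultilinearMap := fieldBracket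
  map_eq_zero_of_eq' v i j hv hij := by
    change ⁅v 0, v 1⁆ = 0
    have : v 0 = v 1 := by
      fin_cases i <;> fin_cases j <;> first | exact absurd rfl hij | exact hv | exact hv.symm
    rw [this, lie_self]

theorem skewKoszulSign_eq_sign {k : ℕ} {deg : Fin k → ℤ} (h : ∀ i, deg i = 0)
    (σ : Equiv.Perm (Fin k)) : skewKoszulSign deg σ = Equiv.Perm.sign σ := by
  simp [skewKoszulSign, h]

theorem contractOmega_perm (k m : ℕ) (v : Fin k → VField A) (σ : Equiv.Perm (Fin k)) :
    contractOmega ω k m (fun i => v (σ i)) =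
      (Equiv.Perm.sign σ : ℤ) • contractOmega ω k m v := by
  by_cases h : p + 2 = m + k
  · rw [contractOmega_of_eq h, contractOmega_of_eq h, smul_comm]
    congr 1
    exact (ctrAlt k h ω).map_perm v σ
  · rw [contractOmega_of_ne h, contractOmega_of_ne h, smul_zero]

theorem obsBracket_skew (k : ℕ) (deg : Fin k → ℤ) (x : Fin k → PreObs A p)
    (hx : ∀ i, x i ∈ obsGrading A p (deg i)) (σ : Equiv.Perm (Fin k)) :
    obsBracket ω k (fun i => x (σ i)) = (skewKoszulSign deg σ : ℤ) • obsBracket ω k x := by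
  match k, deg, x, hx, σ with
  | 0, _, _, _, _ => exact (smul_zero _).symm
  | 1, deg, x, _, σ =>
    obtain rfl : σ = 1 := Subsingleton.elim _ _
    simp [skewKoszulSign]
  | k + 2, deg, x, hx, σ =>
    by_cases h : ∃ i, deg i ≠ 0
    · obtain ⟨i, hi⟩ := h
      have hi := toField_eq_zero_of_mem (hx i) hi
      rw [obsBracket_eq_zero (by omega) ⟨i, hi⟩,
        obsBracket_eq_zero (by omega) ⟨σ.symm i, by simpa using hi⟩, smul_zero]
    · push Not at h
      rw [skewKoszulSign_eq_sign h]
      refine preObs_ext ?_ ?_ fun j => ?_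
      · rw [map_zsmul]
        cases k with
        | zero => exact (fieldBracketAlt A).map_perm (fun i => toField (x i)) σ
        | succ k => rw [toField_obsBracket (by omega), toField_obsBracket (by omega), smul_zero]
      · change _ = (Equiv.Perm.sign σ : ℤ) • (obsBracket ω (k + 2) x).1.2
        rw [obsBracket_fst_snd (by omega), obsBracket_fst_snd (by omega), ← contractOmega_perm]
      · change _ = (Equiv.Perm.sign σ : ℤ) • (obsBracket ω (k + 2) x).2 j
        rw [obsBracket_snd (by omega), obsBracket_snd (by omega), ← contractOmega_perm]

end Observables

/-! ### The higher Jacobi relations -/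

section Jacobi

variable {A : Type*} [CommRing A] [Algebra ℝ A] {p : ℕ} {ω : Form A (p + 2)}

/-- L_v ω = d ι_v ω + ι_v dω = -d dα = 0. -/
theorem lieDeriv_of_mem_observables (hω : extD ω = 0) {x : PreObs A p} (hx : x ∈ observables ω) :
    lieDeriv (toField x) (p + 2) ω = 0 := by
  have h : iota ω (toField x) = -extD x.1.2 := by
    rw [show extD x.1.2 = -iota ω x.1.1 from hx, neg_neg]; rfl
  rw [lieDeriv_succ, hω, h, map_neg, extD_extD, neg_zero, map_zero, LinearMap.zero_apply, add_zero]

theorem extD_ctr_of_lieDeriv_eq_zero (hω : extD ω = 0) {k m : ℕ} (h : p + 2 = m + (k + 1))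
    (v : Fin (k + 1) → VField A) (hv : ∀ i, lieDeriv (v i) (p + 2) ω = 0) :
    extD (ctr (k + 1) h ω v) =
      (-1 : ℤ) ^ (k + 1) • bracketSum (ctr k (m := m + 1) (by omega) ω) v := by
  have h1 := neg_one_pow_extD_ctr h ω v
  simp only [hω, hv, map_zero, zero_apply, smul_zero, Finset.sum_const_zero,
    sub_zero, zero_add] at h1
  rw [← h1, smul_smul, ← mul_pow]
  simp

/-- This recursion characterizes the choice of ς up to a global factor: it absorbs the sign in
`extD_ctr_of_lieDeriv_eq_zero`. -/
theorem koszulSign_succ (k : ℕ) : koszulSign (k + 1) = (-1) ^ (k + 1) * koszulSign k := by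
  have : (k + 1) * (k + 1 + 1) / 2 = k * (k + 1) / 2 + (k + 1) := by
    rw [show (k + 1) * (k + 1 + 1) = k * (k + 1) + (k + 1) * 2 by ring,
      Nat.add_mul_div_right _ _ two_pos]
  rw [koszulSign, koszulSign, this, pow_add]
  ring

theorem bracketSum_smul {W : Type*} [AddCommGroup W] [Module ℝ W] {k : ℕ} (c : ℝ)
    (g : (Fin k → VField A) → W) (v : Fin (k + 1) → VField A) :
    bracketSum (fun u => c • g u) v = c • bracketSum g v := by
  simp only [bracketSum, Finset.smul_sum, smul_ite, smul_zero, smul_comm c]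

theorem map_bracketSum {W W' : Type*} [AddCommGroup W] [Module ℝ W] [AddCommGroup W'] [Module ℝ W']
    (φ : W →ₗ[ℝ] W') {k : ℕ} (g : (Fin k → VField A) → W) (v : Fin (k + 1) → VField A) :
    φ (bracketSum g v) = bracketSum (fun u => φ (g u)) v := by
  simp only [bracketSum, map_sum, apply_ite φ, map_zsmul, map_zero]

/-- In form degree 0 no exact term can compensate the bracket sum. Evaluated on the empty tuple it
is the bracket sum of ω itself, which `bracketSum_eq_zero` handles. -/
theorem bracketSum_ctr_top (hω : extD ω = 0) {k : ℕ} (h : p + 2 = 0 + k)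
    (v : Fin (k + 1) → VField A) (hv : ∀ i, lieDeriv (v i) (p + 2) ω = 0) :
    bracketSum (ctr k h ω) v = 0 := by
  obtain rfl : k = p + 2 := by omega
  ext w
  let φ : Form A 0 →ₗ[ℝ] A :=
    { toFun := fun α => α w, map_add' := fun _ _ => rfl, map_smul' := fun _ _ => rfl }
  have h1 : (fun u => φ (ctr (p + 2) h ω u)) = ω := funext fun u => by
    change ctr (p + 2) h ω u w = _
    rw [ctr_apply, Fin.append_right_nil u w rfl]
    rfl
  change φ _ = 0
  rw [map_bracketSum, h1, bracketSum_eq_zero hω v hv]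

/-- The component of the Jacobi relation in form degree N. Unless N is the degree of the contracted
form, everything is zero; for positive N this is Cartan's formula, for N = 0 it is
`bracketSum_ctr_top`. -/
theorem dComponent_add_sum_contractOmega (hω : extD ω = 0) {k N : ℕ} (hN : N ≤ p)
    (v : Fin (k + 3) → VField A) (hv : ∀ i, lieDeriv (v i) (p + 2) ω = 0) :
    (∑ σ ∈ unshuffles 2 (k + 3), (Equiv.Perm.sign σ : ℤ) • contractOmega ω (k + 2) N
      (Fin.cons ⁅v (σ 0), v (σ 1)⁆ fun b => v (σ b.succ.succ))) +
      dComponent N (fun j : Fin p => contractOmega ω (k + 3) j v) = 0 := by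
  by_cases h : p + 2 = N + (k + 2)
  · have hs := sum_unshuffles_bracket (koszulSign (k + 2) • ctrAlt (k + 2) h ω) v
    simp only [AlternatingMap.smul_apply, ctrAlt_apply] at hs
    simp only [contractOmega_of_eq h]
    rw [hs]
    change -bracketSum (fun u => koszulSign (k + 2) • ctr (k + 2) h ω u) v + _ = 0
    rw [bracketSum_smul]
    cases N with
    | zero =>
      rw [bracketSum_ctr_top hω h v hv]
      simp [dComponent]
    | succ N =>
      rw [dComponent, dif_pos (by omega)]
      change _ + extD (contractOmega ω (k + 3) N v) = 0
      rw [contractOmega_of_eq (by omega), map_smul, extD_ctr_of_lieDeriv_eq_zero hω _ v hv,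
        koszulSign_succ (k + 2), neg_add_eq_zero, ← Int.cast_smul_eq_zsmul ℝ, smul_smul]
      congr 1
      push_cast
      rw [mul_right_comm, ← mul_pow]
      simp
  · simp only [contractOmega_of_ne h, smul_zero, Finset.sum_const_zero, zero_add]
    cases N with
    | zero => rfl
    | succ N =>
      rw [dComponent, dif_pos (by omega)]
      change extD (contractOmega ω (k + 3) N v) = 0
      rw [contractOmega_of_ne (by omega), map_zero]

theorem sum_unshuffles_lie_lie (v : Fin 3 → VField A) :
    ∑ σ ∈ unshuffles 2 3, (Equiv.Perm.sign σ : ℤ) • ⁅⁅v (σ 0), v (σ 1)⁆, v (σ 2)⁆ = 0 := by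
  have h := sum_unshuffles_bracket (fieldBracketAlt A) v
  change ∑ σ ∈ unshuffles 2 3, (Equiv.Perm.sign σ : ℤ) • ⁅⁅v (σ 0), v (σ 1)⁆, v (σ 2)⁆ = _ at h
  rw [h]
  change -bracketSum (fun u : Fin 2 → VField A => ⁅u 0, u 1⁆) v = 0
  have h3 : bracketSum (fun u : Fin 2 → VField A => ⁅u 0, u 1⁆) v =
      -⁅⁅v 0, v 1⁆, v 2⁆ + (⁅⁅v 0, v 2⁆, v 1⁆ + ⁅v 0, ⁅v 1, v 2⁆⁆) := by
    simp [bracketSum, Fin.sum_univ_three, Fin.sum_univ_two, Fin.removeNth_apply,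
      show Fin.succAbove (2 : Fin 3) 1 = 1 from rfl]
  rw [h3, lie_lie (v 0) (v 1) (v 2), lie_lie (v 0) (v 2) (v 1), ← lie_skew (v 2) (v 1), lie_neg,
    ← lie_skew (v 2) ⁅v 0, v 1⁆, lie_lie (v 0) (v 1) (v 2)]
  abel

theorem obsDiff_add_sum_obsBracket (hω : extD ω = 0) {k : ℕ} (x : Fin (k + 3) → PreObs A p)
    (hx : ∀ i, x i ∈ observables ω) :
    (∑ σ ∈ unshuffles 2 (k + 3), (Equiv.Perm.sign σ : ℤ) • obsBracket ω (k + 2)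
      (Fin.cons (obsBracket ω 2 fun a => x (σ ⟨a, by omega⟩)) fun b => x (σ ⟨2 + b, by omega⟩))) +
      obsDiff (obsBracket ω (k + 3) x) = 0 := by
  have hv : ∀ i, lieDeriv (toField (x i)) (p + 2) ω = 0 :=
    fun i => lieDeriv_of_mem_observables hω (hx i)
  have hf : ∀ σ : Equiv.Perm (Fin (k + 3)), (fun i => toField
      ((Fin.cons (obsBracket ω 2 fun a => x (σ ⟨a, by omega⟩)) fun b : Fin (k + 1) =>
        x (σ ⟨2 + b, by omega⟩) : Fin (k + 2) → PreObs A p) i)) =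
      Fin.cons ⁅toField (x (σ 0)), toField (x (σ 1))⁆ fun b => toField (x (σ b.succ.succ)) := by
    intro σ
    funext i
    refine Fin.cases ?_ (fun i => ?_) i
    · rfl
    · simp only [Fin.cons_succ]
      congr 3
      ext
      simp only [Fin.val_succ]
      omega
  refine preObs_ext ?_ ?_ fun j => ?_
  · rw [map_add, map_sum, show toField (obsDiff (obsBracket ω (k + 3) x)) = 0 from rfl, add_zero]
    simp only [map_zsmul]
    cases k with
    | zero => exact sum_unshuffles_lie_lie fun i => toField (x i)
    | succ k =>
      exact Finset.sum_eq_zero fun σ _ => by rw [toField_obsBracket (by omega), smul_zero]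
  · refine Eq.trans ?_ (dComponent_add_sum_contractOmega hω le_rfl (fun i => toField (x i)) hv)
    let π : PreObs A p →ₗ[ℝ] Form A p := LinearMap.snd ℝ _ _ ∘ₗ LinearMap.fst ℝ _ _
    change π (_ + _) = _
    rw [map_add, map_sum]
    congr 1
    · refine Finset.sum_congr rfl fun σ _ => ?_
      rw [map_zsmul]
      congr 1
      exact (obsBracket_fst_snd (by omega) _).trans (by rw [hf])
  · refine Eq.trans ?_ (dComponent_add_sum_contractOmega hω j.2.le (fun i => toField (x i)) hv)
    let π : PreObs A p →ₗ[ℝ] Form A j := LinearMap.proj j ∘ₗ LinearMap.snd ℝ _ _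
    change π (_ + _) = _
    rw [map_add, map_sum]
    congr 1
    refine Finset.sum_congr rfl fun σ _ => ?_
    rw [map_zsmul]
    congr 1
    exact (obsBracket_snd (by omega) _ j).trans (by rw [hf])

/-- The outer arity in the last Jacobi term is m - (i + 1) + 1, which is 1 only after arithmetic;
hence the hypothesis n = 0. -/
theorem obsBracket_cons_of_eq_zero {n : ℕ} (hn : n = 0) (y : PreObs A p) (z : Fin n → PreObs A p) :
    obsBracket ω (n + 1) (Fin.cons y z) = obsDiff y := by
  subst hn
  rfl

theorem sum_unshuffles_last {m i : ℕ} (h : m = i + 1) (x : Fin m → PreObs A p) :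
    ∑ σ ∈ unshuffles (i + 1) m,
      ((-1) ^ ((i + 1) * (m - (i + 1))) * (Equiv.Perm.sign σ : ℤ)) •
        obsBracket ω (m - (i + 1) + 1) (Fin.cons (obsBracket ω (i + 1) fun a => x (σ ⟨a, by omega⟩))
          fun b => x (σ ⟨i + 1 + b, by omega⟩)) = obsDiff (obsBracket ω m x) := by
  subst h
  rw [unshuffles_self, Finset.sum_singleton, obsBracket_cons_of_eq_zero (by omega)]
  simp

theorem obsBracket_cons_zero (n : ℕ) {y : PreObs A p} (hy : y = 0) (z : Fin n → PreObs A p) :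
    obsBracket ω (n + 1) (Fin.cons y z) = 0 :=
  (obsBracket ω (n + 1)).map_coord_zero 0 (by simpa using hy)

/-- An entry without field kills an outer bracket directly, or an inner bracket with two or more
inputs. If the inner bracket is l_1, its output has no field, and the outer one has m ≥ 2 inputs. -/
theorem obsBracket_obsBracket_eq_zero {m i : ℕ} (hm : 2 ≤ m) (him : i < m)
    (z : Fin m → PreObs A p) (h : ∃ a, toField (z a) = 0) :
    obsBracket ω (m - (i + 1) + 1) (Fin.cons (obsBracket ω (i + 1) fun a => z ⟨a, by omega⟩)
      fun b => z ⟨i + 1 + b, by omega⟩) = 0 := by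
  obtain ⟨a, ha⟩ := h
  by_cases hc : (a : ℕ) < i + 1
  · rcases Nat.eq_zero_or_pos i with rfl | hi
    · exact obsBracket_eq_zero (by omega) ⟨0, rfl⟩
    · exact obsBracket_cons_zero _ (obsBracket_eq_zero (by omega) ⟨⟨a, hc⟩, ha⟩) _
  · refine obsBracket_eq_zero (by omega) ⟨Fin.succ ⟨a - (i + 1), by omega⟩, ?_⟩
    rw [Fin.cons_succ, ← ha]
    congr 2
    ext
    simp only
    omega

theorem jacobiator_obsBracket (hω : extD ω = 0) (m : ℕ) (deg : Fin m → ℤ) (x : Fin m → PreObs A p)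
    (hx : ∀ i, x i ∈ obsGrading A p (deg i)) (hobs : ∀ i, x i ∈ observables ω) :
    jacobiator (obsBracket ω) deg x = 0 := by
  match m, deg, x, hx, hobs with
  | 0, _, _, _, _ => simp [jacobiator]
  | 1, deg, x, hx, hobs =>
    simp only [jacobiator, Fin.sum_univ_one]
    refine Finset.sum_eq_zero fun σ _ => ?_
    exact (congrArg _ (obsDiff_obsDiff _)).trans (smul_zero _)
  | m + 2, deg, x, hx, hobs =>
    by_cases h : ∃ i, deg i ≠ 0
    · obtain ⟨i, hi⟩ := h
      have hi := toField_eq_zero_of_mem (hx i) hi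
      refine Finset.sum_eq_zero fun k _ => Finset.sum_eq_zero fun σ _ => ?_
      rw [obsBracket_obsBracket_eq_zero (by omega) k.2 (fun a => x (σ a))
        ⟨σ.symm i, by simpa using hi⟩, smul_zero]
    push Not at h
    have h0 : ∀ i, (x i).2 = 0 := fun i => snd_eq_zero_of_mem (h i ▸ hx i)
    unfold jacobiator
    simp only [skewKoszulSign_eq_sign h]
    -- Index 0 is the term with l_1 inside, which is zero on pairs; the last index is l_1 ∘ l_m. Of
    -- the terms between, only the one with l_2 inside will survive.
    rw [Fin.sum_univ_succ]
    refine (congrArg₂ (· + ·) (Finset.sum_eq_zero fun σ _ => (congrArg _ (obsBracket_cons_zero _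
      (obsDiff_eq_zero (h0 _)) _)).trans (smul_zero _)) rfl).trans ?_
    rw [zero_add, Fin.sum_univ_castSucc,
      sum_unshuffles_last (m := m + 2) (i := (Fin.last m).succ) rfl x]
    cases m with
    | zero => rw [Fin.sum_univ_zero, zero_add]; exact obsDiff_eq_zero rfl
    | succ m =>
      rw [Fin.sum_univ_succ, Finset.sum_eq_zero fun i _ => Finset.sum_eq_zero fun σ _ => ?_,
        add_zero]
      · refine Eq.trans ?_ (obsDiff_add_sum_obsBracket hω x hobs)
        congr 1
        refine Finset.sum_congr rfl fun σ _ => ?_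
        refine congrArg₂ (fun (a : ℤ) (z : PreObs A p) => a • z) ?_ rfl
        change (-1 : ℤ) ^ (2 * (m + 1)) * _ = _
        rw [pow_mul, neg_one_sq, one_pow, one_mul]
      -- Here the inner bracket has at least three inputs, so its value has no field, while the
      -- outer bracket still has at least two.
      · refine (congrArg _ (obsBracket_eq_zero ?_ ⟨0, ?_⟩)).trans (smul_zero _)
        · have := i.2
          simp
          omega
        · rw [Fin.cons_zero, toField_obsBracket]
          simp

end Jacobi

/-! ### Reducible and vanishing observables -/

section ReducibleObservables

variable {A : Type*} [CommRing A] [Algebra ℝ A] {J : Ideal A}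
  {𝔤 : Type*} [LieRing 𝔤] [LieAlgebra ℝ 𝔤] {ρ : 𝔤 →ₗ⁅ℝ⁆ VField A} {p : ℕ} {ω : Form A (p + 2)}

theorem ctr_mem_reducibleForms (hJ : VanishingIsTensorial J) : ∀ {k n m : ℕ} (h : n = m + k)
    {α : Form A n}, α ∈ reducibleForms J ρ n → ∀ {v : Fin k → VField A},
    (∀ i, v i ∈ reducibleFields J ρ) → ctr k h α v ∈ reducibleForms J ρ m
  | 0, _, _, rfl, _, hα, _, _ => hα
  | k + 1, n, m, h, α, hα, v, hv => by
    obtain ⟨n, rfl⟩ : ∃ n', n = n' + 1 := ⟨m + k, h⟩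
    rw [ctr_succ]
    exact ctr_mem_reducibleForms hJ _ (iota_mem_reducibleForms hJ hα (hv 0)) fun i => hv i.succ

theorem contractOmega_mem_reducibleForms (hJ : VanishingIsTensorial J)
    (hred : ω ∈ reducibleForms J ρ (p + 2)) {k m : ℕ} {v : Fin k → VField A}
    (hv : ∀ i, v i ∈ reducibleFields J ρ) : contractOmega ω k m v ∈ reducibleForms J ρ m := by
  by_cases h : p + 2 = m + k
  · rw [contractOmega_of_eq h]
    exact Submodule.smul_mem _ _ (ctr_mem_reducibleForms hJ h hred hv)
  · rw [contractOmega_of_ne h]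
    exact zero_mem _

/-- Moving the trivial entry to the front costs only a sign and makes the value one of a contraction
with that field. -/
theorem apply_mem_of_mem_trivialFields (hJ : VanishingIsTensorial J) {q : ℕ} {α : Form A q}
    (hα : α ∈ reducibleForms J ρ q) {u : Fin q → VField A} (hu : ∀ i, IsTangent J (u i))
    (h : ∃ i, u i ∈ trivialFields J ρ) : α u ∈ J := by
  obtain ⟨i, hi⟩ := h
  obtain ⟨q, rfl⟩ : ∃ q', q = q' + 1 := ⟨q - 1, by have := i.2; omega⟩
  have h1 := neg_one_pow_smul_cons_removeNth α u i (u i)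
  rw [Function.update_eq_self] at h1
  rw [← h1]
  exact zsmul_mem (mem_vanishingForms.1 (iota_mem_vanishingForms_of_trivial hJ hα hi)
    (i.removeNth u) fun l => hu _) _

theorem contractOmega_mem_vanishingForms (hJ : VanishingIsTensorial J)
    (hred : ω ∈ reducibleForms J ρ (p + 2)) {k m : ℕ} {v : Fin k → VField A}
    (hv : ∀ i, IsTangent J (v i)) (h : ∃ i, v i ∈ trivialFields J ρ) :
    contractOmega ω k m v ∈ vanishingForms J m := by
  by_cases hk : p + 2 = m + k
  · rw [contractOmega_of_eq hk]
    refine Submodule.smul_mem _ _ (mem_vanishingForms.2 fun w hw => ?_)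
    rw [ctr_apply]
    refine apply_mem_of_mem_trivialFields hJ hred (fun i => ?_) ?_
    · have : ∀ i, IsTangent J (Fin.append v w i) := Fin.addCases (by simpa using hv)
        (by simpa using hw)
      exact this _
    · obtain ⟨i, hi⟩ := h
      exact ⟨Fin.cast (by omega) (Fin.castAdd m i), by simpa using hi⟩
  · rw [contractOmega_of_ne hk]
    exact zero_mem _

theorem dComponent_mem {S : ∀ k : ℕ, Submodule ℝ (Form A k)}
    (hS : ∀ (k : ℕ) (α : Form A k), α ∈ S k → extD α ∈ S (k + 1)) {β : ∀ j : Fin p, Form A j}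
    (hβ : ∀ j : Fin p, β j ∈ S j) : ∀ m, dComponent m β ∈ S m
  | 0 => zero_mem _
  | m + 1 => by
    rw [dComponent]
    split_ifs with h
    · exact hS m _ (hβ ⟨m, h⟩)
    · exact zero_mem _

/-- The Hamilton equation for l_2: with two fields the bracket sum has a single term, and ς(2) = 1.
-/
theorem extD_contractOmega_two (hω : extD ω = 0) (v : Fin 2 → VField A)
    (hv : ∀ i, lieDeriv (v i) (p + 2) ω = 0) :
    extD (contractOmega ω 2 p v) = -iota ω ⁅v 0, v 1⁆ := by
  rw [contractOmega_of_eq rfl, map_smul, extD_ctr_of_lieDeriv_eq_zero hω rfl v hv]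
  have h : bracketSum (ctr 1 (m := p + 1) rfl ω) v = -iota ω ⁅v 0, v 1⁆ := by
    simp [bracketSum, Fin.sum_univ_two, ctr_succ]
    rfl
  rw [h]
  simp [koszulSign, Odd.neg_one_pow (show Odd 3 by decide)]

theorem obsBracket_mem_reducibleObservables (hJ : VanishingIsTensorial J) (hω : extD ω = 0)
    (hred : ω ∈ reducibleForms J ρ (p + 2)) (k : ℕ) (y : Fin k → PreObs A p)
    (hy : ∀ i, y i ∈ reducibleObservables J ρ ω) :
    obsBracket ω k y ∈ reducibleObservables J ρ ω := by
  match k, y, hy with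
  | 0, _, _ => exact zero_mem _
  | 1, y, hy =>
    rw [obsBracket_one]
    have h := dComponent_mem (S := fun k => reducibleForms J ρ k)
      (fun _ _ => extD_mem_reducibleForms) (hy 0).2.2.2
    refine ⟨?_, zero_mem _, h p, fun j => h j⟩
    change extD (dComponent p (y 0).2) = -iota ω 0
    rw [map_zero, neg_zero]
    -- For p = 0 there are no forms of lower degree and the component is zero; otherwise the
    -- Hamilton equation for (0, dβ) is d dβ = 0.
    cases p with
    | zero => exact map_zero _
    | succ p =>
      rw [dComponent, dif_pos (by omega)]
      exact extD_extD _
  | k + 2, y, hy =>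
    refine ⟨?_, ?_, ?_, fun j => ?_⟩
    · change extD (obsBracket ω (k + 2) y).1.2 = -iota ω (toField (obsBracket ω (k + 2) y))
      rw [obsBracket_fst_snd (by omega)]
      cases k with
      | zero => exact extD_contractOmega_two hω _ fun i => lieDeriv_of_mem_observables hω (hy i).1
      | succ k =>
        rw [contractOmega_of_ne (by omega), toField_obsBracket (by omega), map_zero, map_zero,
          neg_zero]
    · cases k with
      | zero => exact lie_mem_reducibleFields (hy 0).2.1 (hy 1).2.1
      | succ k => exact zero_mem _
    · rw [obsBracket_fst_snd (by omega)]
      exact contractOmega_mem_reducibleForms hJ hred fun i => (hy i).2.1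
    · rw [obsBracket_snd (by omega)]
      exact contractOmega_mem_reducibleForms hJ hred fun i => (hy i).2.1

/-- Replaces the span by conditions on the components, splitting x into its pair and its lower
forms. Tangency of the fundamental fields makes vanishing forms reducible, whence the containment in
the reducible observables. -/
theorem mem_vanishingObservables (hρ : ∀ ξ, IsTangent J (ρ ξ)) {x : PreObs A p} :
    x ∈ vanishingObservables J ρ ω ↔ x ∈ reducibleObservables J ρ ω ∧
      x.1.1 ∈ trivialFields J ρ ∧ x.1.2 ∈ vanishingForms J p ∧
      ∀ j : Fin p, x.2 j ∈ vanishingForms J j := by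
  constructor
  · intro hx
    refine Submodule.span_induction ?_ ?_ ?_ ?_ hx
    · rintro x (⟨h1, h2⟩ | ⟨h1, h2, h3, h4⟩)
      · refine ⟨⟨?_, ?_, ?_, fun j => vanishingForms_le_reducibleForms hρ j (h2 j)⟩, ?_, ?_, h2⟩
        · change extD x.1.2 = -iota ω x.1.1
          simp [h1]
        all_goals rw [h1]; exact zero_mem _
      · exact ⟨h1, h3, h4, fun j => by rw [h2]; exact zero_mem _⟩
    · exact ⟨zero_mem _, zero_mem _, zero_mem _, fun _ => zero_mem _⟩
    · exact fun x y _ _ hx hy => ⟨add_mem hx.1 hy.1, add_mem hx.2.1 hy.2.1,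
        add_mem hx.2.2.1 hy.2.2.1, fun j => add_mem (hx.2.2.2 j) (hy.2.2.2 j)⟩
    · exact fun c x _ hx => ⟨Submodule.smul_mem _ c hx.1, Submodule.smul_of_tower_mem _ c hx.2.1,
        Submodule.smul_mem _ c hx.2.2.1, fun j => Submodule.smul_mem _ c (hx.2.2.2 j)⟩
  · rintro ⟨⟨h1, h2, h3, h4⟩, h5, h6, h7⟩
    have : x = (x.1, 0) + (0, x.2) := by simp
    rw [this]
    exact add_mem (Submodule.subset_span (Or.inr ⟨⟨h1, h2, h3, fun j => zero_mem _⟩, rfl, h5, h6⟩))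
      (Submodule.subset_span (Or.inl ⟨rfl, h7⟩))

/-- Vanishing forms are stable under d, which settles l_1. For the other brackets, one trivial field
makes the contraction of ω vanishing, and the bracket of a trivial with a reducible field is
trivial. -/
theorem obsBracket_mem_vanishingObservables (hJ : VanishingIsTensorial J)
    (hρ : ∀ ξ, IsTangent J (ρ ξ)) (hω : extD ω = 0)
    (hred : ω ∈ reducibleForms J ρ (p + 2)) (k : ℕ) (y : Fin k → PreObs A p)
    (hy : ∀ i, y i ∈ reducibleObservables J ρ ω) (h : ∃ i, y i ∈ vanishingObservables J ρ ω) :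
    obsBracket ω k y ∈ vanishingObservables J ρ ω := by
  refine (mem_vanishingObservables hρ).2
    ⟨obsBracket_mem_reducibleObservables hJ hω hred k y hy, ?_⟩
  obtain ⟨i, hi⟩ := h
  have hi := (mem_vanishingObservables hρ).1 hi
  match k, y, hy, i, hi with
  | 1, y, _, i, hi =>
    obtain rfl : i = 0 := Subsingleton.elim _ _
    have h := dComponent_mem (S := fun k => vanishingForms J k)
      (fun _ _ => extD_mem_vanishingForms) hi.2.2.2
    exact ⟨zero_mem _, h p, fun j => h j⟩
  | k + 2, y, hy, i, hi =>
    have h : ∀ m, contractOmega ω (k + 2) m (fun i => toField (y i)) ∈ vanishingForms J m :=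
      fun m => contractOmega_mem_vanishingForms hJ hred (fun i => (hy i).2.1.1) ⟨i, hi.2.1⟩
    refine ⟨?_, ?_, fun j => ?_⟩
    · cases k with
      | zero =>
        change ⁅toField (y 0), toField (y 1)⁆ ∈ trivialFields J ρ
        fin_cases i
        · rw [← lie_skew]
          exact neg_mem (lie_mem_trivialFields (hy 1).2.1 hi.2.1)
        · exact lie_mem_trivialFields (hy 0).2.1 hi.2.1
      | succ k => exact zero_mem _
    · rw [obsBracket_fst_snd (by omega)]; exact h p
    · rw [obsBracket_snd (by omega)]; exact h j

/-! ### Projections to the homogeneous parts, and the assembled algebra and ideal. -/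

/-- The projection to the part of degree `i`. -/
def gradingProj (A : Type*) [CommRing A] [Algebra ℝ A] (p : ℕ) (i : ℤ) :
    PreObs A p →ₗ[ℝ] PreObs A p where
  toFun x := (if i = 0 then x.1 else 0, fun j => if ((j : ℕ) : ℤ) = p + i then x.2 j else 0)
  map_add' x y := by
    refine Prod.ext ?_ (funext fun j => ?_)
    · change (if i = 0 then x.1 + y.1 else 0) =
        (if i = 0 then x.1 else 0) + if i = 0 then y.1 else 0
      split_ifs <;> simp
    · change (if ((j : ℕ) : ℤ) = p + i then x.2 j + y.2 j else 0) =
        (if ((j : ℕ) : ℤ) = p + i then x.2 j else 0) + if ((j : ℕ) : ℤ) = p + i then y.2 j else 0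
      split_ifs <;> simp
  map_smul' c x := by
    refine Prod.ext ?_ (funext fun j => ?_)
    · change (if i = 0 then c • x.1 else 0) = c • (if i = 0 then x.1 else 0)
      split_ifs <;> simp
    · change (if ((j : ℕ) : ℤ) = p + i then c • x.2 j else 0) =
        c • (if ((j : ℕ) : ℤ) = p + i then x.2 j else 0)
      split_ifs <;> simp

theorem gradingProj_fst (i : ℤ) (x : PreObs A p) :
    (gradingProj A p i x).1 = if i = 0 then x.1 else 0 := rfl

theorem gradingProj_snd (i : ℤ) (x : PreObs A p) (j : Fin p) :
    (gradingProj A p i x).2 j = if ((j : ℕ) : ℤ) = p + i then x.2 j else 0 := rfl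

theorem gradingProj_mem (i : ℤ) (x : PreObs A p) : gradingProj A p i x ∈ obsGrading A p i :=
  ⟨fun hi => if_neg hi, fun _ hj => if_neg hj⟩

theorem gradingProj_of_mem {i : ℤ} {x : PreObs A p} (hx : x ∈ obsGrading A p i) :
    gradingProj A p i x = x := by
  refine Prod.ext ?_ (funext fun j => ?_)
  · rw [gradingProj_fst]
    split_ifs with h
    · rfl
    · exact (hx.1 h).symm
  · rw [gradingProj_snd]
    split_ifs with h
    · rfl
    · exact (hx.2 j h).symm

theorem gradingProj_of_mem_ne {i j : ℤ} (hij : j ≠ i) {x : PreObs A p}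
    (hx : x ∈ obsGrading A p j) : gradingProj A p i x = 0 := by
  refine Prod.ext ?_ (funext fun l => ?_)
  · rw [gradingProj_fst]
    split_ifs with h
    · exact hx.1 (by omega)
    · rfl
  · rw [gradingProj_snd]
    split_ifs with h
    · exact hx.2 l (by omega)
    · rfl

theorem sum_gradingProj (x : PreObs A p) :
    ∑ i ∈ Finset.Icc (-(p : ℤ)) 0, gradingProj A p i x = x := by
  refine Prod.ext ?_ (funext fun j => ?_)
  · rw [Prod.fst_sum]
    simp only [gradingProj_fst]
    rw [Finset.sum_ite_eq']
    simp
  · rw [Prod.snd_sum, Finset.sum_apply]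
    simp only [gradingProj_snd]
    have h : ∀ i : ℤ, ((j : ℕ) : ℤ) = p + i ↔ i = j - p := fun i => by omega
    simp only [h]
    rw [Finset.sum_ite_eq', if_pos]
    have := j.2
    simp only [Finset.mem_Icc]
    omega

theorem isGradingProj_gradingProj : IsGradingProj (obsGrading A p) (gradingProj A p) where
  mem := gradingProj_mem
  of_mem := gradingProj_of_mem
  of_mem_ne h hx := gradingProj_of_mem_ne h hx
  exists_sum x := ⟨_, sum_gradingProj x⟩

theorem gradingProj_mem_reducibleObservables {x : PreObs A p}
    (hx : x ∈ reducibleObservables J ρ ω) (i : ℤ) :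
    gradingProj A p i x ∈ reducibleObservables J ρ ω := by
  refine ⟨?_, ?_, ?_, fun j => ?_⟩
  · change extD (gradingProj A p i x).1.2 = -iota ω (gradingProj A p i x).1.1
    rw [gradingProj_fst]
    split_ifs
    · exact hx.1
    · simp
  · rw [gradingProj_fst]
    split_ifs
    exacts [hx.2.1, zero_mem _]
  · rw [gradingProj_fst]
    split_ifs
    exacts [hx.2.2.1, zero_mem _]
  · rw [gradingProj_snd]
    split_ifs
    exacts [hx.2.2.2 j, zero_mem _]

theorem gradingProj_mem_vanishingObservables (hρ : ∀ ξ, IsTangent J (ρ ξ)) {x : PreObs A p}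
    (hx : x ∈ vanishingObservables J ρ ω) (i : ℤ) :
    gradingProj A p i x ∈ vanishingObservables J ρ ω := by
  rw [mem_vanishingObservables hρ] at hx ⊢
  refine ⟨gradingProj_mem_reducibleObservables hx.1 i, ?_, ?_, fun j => ?_⟩
  · rw [gradingProj_fst]
    split_ifs
    exacts [hx.2.1, zero_mem _]
  · rw [gradingProj_fst]
    split_ifs
    exacts [hx.2.2.1, zero_mem _]
  · rw [gradingProj_snd]
    split_ifs
    exacts [hx.2.2.2 j, zero_mem _]

/-- The multibrackets of the reducible observables. -/
def reducibleBracket (hJ : VanishingIsTensorial J) (hω : extD ω = 0)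
    (hred : ω ∈ reducibleForms J ρ (p + 2)) : MultiBrackets (reducibleObservables J ρ ω) :=
  restrictBrackets (obsBracket ω) _ (obsBracket_mem_reducibleObservables hJ hω hred)

theorem isLInfinityAlgebra_reducibleBracket (hJ : VanishingIsTensorial J) (hω : extD ω = 0)
    (hred : ω ∈ reducibleForms J ρ (p + 2)) :
    IsLInfinityAlgebra (subGrading (reducibleObservables J ρ ω)) (reducibleBracket hJ hω hred) :=
  isLInfinityAlgebra_of_isRestriction (isRestriction_restrictBrackets _ _ _)
    (isGradingProj_gradingProj.isInternal_submoduleOf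
      fun _ hx i => gradingProj_mem_reducibleObservables hx i)
    rfl obsBracket_mem_obsGrading obsBracket_skew
    fun m deg x hx hS => jacobiator_obsBracket hω m deg x hx fun i => (hS i).1

theorem isStrictIdeal_vanishingInReducible (hJ : VanishingIsTensorial J)
    (hρ : ∀ ξ, IsTangent J (ρ ξ)) (hω : extD ω = 0) (hred : ω ∈ reducibleForms J ρ (p + 2)) :
    IsStrictIdeal (subGrading (reducibleObservables J ρ ω)) (reducibleBracket hJ hω hred)
      (vanishingInReducible J ρ ω) :=
  isStrictIdeal_of_isRestriction (isRestriction_restrictBrackets _ _ _) isGradingProj_gradingProj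
    (fun _ hx i => gradingProj_mem_reducibleObservables hx i)
    (fun _ hx i => gradingProj_mem_vanishingObservables hρ hx i)
    (obsBracket_mem_vanishingObservables hJ hρ hω hred)

end ReducibleObservables

end MultisymplecticReduction

end

theorem mainTheorem3 {d : ℕ} {M : Type*} [TopologicalSpace M] [T2Space M] [ParacompactSpace M]
    [ChartedSpace (EuclideanSpace ℝ (Fin d)) M] [IsManifold (𝓡 d) ((⊤ : ℕ∞) : WithTop ℕ∞) M]
    {𝔤 : Type*} [LieRing 𝔤] [LieAlgebra ℝ 𝔤]
    (ρ : 𝔤 →ₗ⁅ℝ⁆ VField (SmoothFn d M)) (N : Set M)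
    (hρ : ∀ ξ : 𝔤, IsTangent (vanishingIdeal d N) (ρ ξ))
    {p : ℕ} (ω : Form (SmoothFn d M) (p + 2)) (hω : extD ω = 0)
    (hred : ω ∈ reducibleForms (vanishingIdeal d N) ρ (p + 2)) :
    vanishingObservables (vanishingIdeal d N) ρ ω ≤
        reducibleObservables (vanishingIdeal d N) ρ ω ∧
      ∃ lS : MultiBrackets (reducibleObservables (vanishingIdeal d N) ρ ω),
        IsRestriction (obsBracket ω) lS ∧
        IsLInfinityAlgebra (subGrading (reducibleObservables (vanishingIdeal d N) ρ ω)) lS ∧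
        IsStrictIdeal (subGrading (reducibleObservables (vanishingIdeal d N) ρ ω)) lS
          (vanishingInReducible (vanishingIdeal d N) ρ ω) ∧
        HasQuotientAlgebra (subGrading (reducibleObservables (vanishingIdeal d N) ρ ω)) lS
          (vanishingInReducible (vanishingIdeal d N) ρ ω) := by
  -- The only property of the manifold that the algebra below requires.
  have hJ : VanishingIsTensorial (vanishingIdeal d N) := fun φ _ hu =>
    apply_mem_vanishingIdeal N φ hu
  exact ⟨fun _ hx => ((mem_vanishingObservables hρ).1 hx).1, reducibleBracket hJ hω hred,
    isRestriction_restrictBrackets _ _ _, isLInfinityAlgebra_reducibleBracket hJ hω hred,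
    isStrictIdeal_vanishingInReducible hJ hρ hω hred,
    hasQuotientAlgebra (isLInfinityAlgebra_reducibleBracket hJ hω hred)
      (isStrictIdeal_vanishingInReducible hJ hρ hω hred)⟩
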